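/- Let $(K,d)$ be a compact metric space, $N\ge 2$, $\Sigma=\{0,\dots,N-1\}$, and let $\gamma=(\gamma_0,\dots,\gamma_{N-1})$ be a self-similar map on $K$: each $\gamma_i:K\to K$ satisfies $c_i'd(x,y)\le d(\gamma_i(x),\gamma_i(y))\le c_i d(x,y)$ with constants $0<c_i'\le c_i<1$, and $K=\bigcup_i\gamma_i(K)$. For $w=(i_1,\dots,i_k)\in\Sigma^k$ put $\gamma_w=\gamma_{i_k}\circ\cdots\circ\gamma_{i_1}$. Let $B_\gamma=\{b : b=\gamma_i(a)=\gamma_j(a)\text{ for some }a\in K,\ i\ne j\}$ be the set of branched points and $P_\gamma=\{a:\gamma_w(a)\in B_\gamma\text{ for some }k\ge1,\ w\in\Sigma^k\}$ the postcritical set. Assume Assumption B: there is a continuous $h:K\to K$ with $h\circ\gamma_j=\mathrm{id}$ for all $j$; $B_\gamma$ is finite; and $B_\gamma\cap P_\gamma=\emptyset$. Let $A=C(K)$, and let $X=C(\{(\gamma_j(y),y): j\in\Sigma,\ y\in K\})$ be the $C^*$-correspondence over $A$ with $(a\cdot f\cdot b)(\gamma_j(y),y)=a(\gamma_j(y))f(\gamma_j(y),y)b(y)$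 and $(f|g)_A(y)=\sum_j\overline{f(\gamma_j(y),y)}g(\gamma_j(y),y)$. Let $X^{\otimes n}$ be its $n$-fold inner tensor product ($X^{\otimes 0}=A$) and $\mathcal K(X^{\otimes n})$ the compact operators on it, and let $$\mathcal F^{(n)}=A\otimes I+\mathcal K(X)\otimes I+\cdots+\mathcal K(X^{\otimes n})\subset\mathcal L(X^{\otimes n})$$ be the finite $n$-th core. Embed $X^{\otimes r}$ isometrically in $A^{N^r}$ (coordinates labelled by $\Sigma^r$) by $\varphi(x_1\otimes\cdots\otimes x_r)_{(i_1,\dots,i_r)}(y)=\prod_{k=1}^r x_{r+1-k}(y_k,y_{k-1})$, where $y_k=\gamma_{(i_1,\dots,i_k)}(y)$, and let $\Omega^{(r)}:\mathcal K(X^{\otimes r})\to M_{N^r}(A)=C(K,M_{N^r}(\mathbb C))$ be the continuous linear map with $\Omega^{(r)}(\theta_{x,y})=\theta_{\varphi(x),\varphi(y)}$. For $p+q=n$, $u\in\Sigma^p$ and $T\in M_{N^q}(\mathbb C)$ let $\pi_{q,u}(T)\in M_{N^n}(\mathbb C)$ be the block matrix with $T$ in the $u$-th diagonal block and zeros elsewhere.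 Let $\Pi^{(n)}:\mathcal F^{(n)}\to M_{N^n}(A)$ be the matrix representation, that is, the unique linear map with $$\Pi^{(n)}(T\otimes I)(y)=\sum_{u\in\Sigma^{n-r}}\pi_{r,u}\bigl(\Omega^{(r)}(T)(\gamma_u(y))\bigr)\qquad(0\le r\le n,\ T\in\mathcal K(X^{\otimes r}),\ y\in K).$$ For $\mathcal A\subset M_{N^n}(A)$ write $\mathcal A(P)=\{T(P):T\in\mathcal A\}$ for its fiber at $P\in K$. For $R\in B_\gamma$ and $1\le p\le n$ with $h^p(R)=P$, put $q=n-p$ and $$\tilde C(P,R,p)=\Bigl\{\sum_{u\in\Sigma^p,\ \gamma_u(P)=R}\pi_{q,u}(T)\ :\ T\in M_{N^q}(\mathbb C)\Bigr\}\subset M_{N^n}(\mathbb C).$$ **Theorem.** Let $n\ge0$ and $P\in P_\gamma$. Then $$\Pi^{(n)}(\mathcal F^{(n)})(P)=\Pi^{(n)}(\mathcal K(X^{\otimes n}))(P)+\Bigl(\bigoplus_{1\le p\le n,\ R\in B_\gamma,\ h^p(R)=P}\tilde C(P,R,p)\Bigr).$$ The sum over the pairs $(p,R)$ is direct, and the first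 and the second term are linearly independent subspaces of $M_{N^n}(\mathbb C)$. Thus the right hand side is a direct sum of vector spaces; it is not an orthogonal sum of $*$-algebras: for every pair $(p,R)$ in the index set there are $S\in\Pi^{(n)}(\mathcal K(X^{\otimes n}))(P)$ and $T\in\tilde C(P,R,p)$ with $ST\ne0$. -/

import Mathlib

set_option linter.unusedSectionVars false

section SelfSimilarMaps

variable {K : Type*} [MetricSpace K] {N : ℕ}

/-- `f` is a proper contraction: `c' d(x,y) ≤ d(f x, f y) ≤ c d(x,y)` with `0 < c' ≤ c < 1`. -/
def IsProperContraction (f : K → K) : Prop :=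
  ∃ c' c : ℝ, 0 < c' ∧ c' ≤ c ∧ c < 1 ∧
    ∀ x y, c' * dist x y ≤ dist (f x) (f y) ∧ dist (f x) (f y) ≤ c * dist x y

/-- `γ = (γ_0, …, γ_{N-1})` is a self-similar map on `K`: `N ≥ 2` proper contractions whose
images cover `K`.  (The continuity bundled in `C(K, K)` is automatic for contractions.) -/
structure IsSelfSimilarMap (γ : Fin N → C(K, K)) : Prop where
  two_le : 2 ≤ N
  contraction : ∀ i, IsProperContraction (γ i)
  cover : (⋃ i, Set.range (γ i)) = Set.univ

/-- Words `(i_1, …, i_n)` over the alphabet `Σ = {0, …, N-1}`; the letter `i_k` is `w (k-1)`. -/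
abbrev Word (N n : ℕ) : Type := Fin n → Fin N

/-- `wordMap γ n (i_1, …, i_n) = γ_{i_n} ∘ ⋯ ∘ γ_{i_1}` (the letter `i_1` is applied first). -/
def wordMap (γ : Fin N → C(K, K)) : (n : ℕ) → Word N n → C(K, K)
  | 0, _ => ContinuousMap.id K
  | n + 1, w => (wordMap γ n (Fin.tail w)).comp (γ (w 0))

/-- The set `B_γ` of branched points. -/
def branchSet (γ : Fin N → C(K, K)) : Set K :=
  {b | ∃ a i j, i ≠ j ∧ b = γ i a ∧ b = γ j a}

/-- The postcritical set `P_γ`. -/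
def postcriticalSet (γ : Fin N → C(K, K)) : Set K :=
  {a | ∃ k, 1 ≤ k ∧ ∃ w : Word N k, wordMap γ k w a ∈ branchSet γ}

/-- Assumption B, with `h` the common left inverse of all the branches. -/
structure AssumptionB (γ : Fin N → C(K, K)) (h : K → K) : Prop where
  continuous_h : Continuous h
  left_inv : ∀ j y, h (γ j y) = y
  finite_branchSet : (branchSet γ).Finite
  branchSet_inter : branchSet γ ∩ postcriticalSet γ = ∅

end SelfSimilarMaps

section Words

variable {N p q n : ℕ}

/-- For `p + q = n`, the first `p` letters `(i_1, …, i_p)` of `(i_1, …, i_n)`. -/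
def wordPre (h : p + q = n) (w : Word N n) : Word N p := fun k => w ⟨k, by omega⟩

/-- For `p + q = n`, the last `q` letters `(i_{p+1}, …, i_n)` of `(i_1, …, i_n)`. -/
def wordSuf (h : p + q = n) (w : Word N n) : Word N q := fun k => w ⟨p + k, by omega⟩

end Words

section Modules

variable {K : Type*} [MetricSpace K] [CompactSpace K] {N : ℕ}

/-- The free Hilbert module `Y_γ^{⊗ n} = A^{N^n}` over `A = C(K)`, as continuous functions
`K → ℂ^{N^n}`; the `N^n` coordinates are labelled by words instead of by their `N`-adic values
`i_1 … i_n|_{(N,n)}`.  The norm `sup_y ‖f y‖` is the Hilbert module norm `‖(f|f)_A‖^{1/2}`. -/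
def FreeModule (K : Type*) [TopologicalSpace K] (N n : ℕ) : Type _ :=
  C(K, EuclideanSpace ℂ (Word N n))

namespace FreeModule

variable {n : ℕ}

noncomputable instance : NormedAddCommGroup (FreeModule K N n) :=
  inferInstanceAs (NormedAddCommGroup C(K, EuclideanSpace ℂ (Word N n)))

noncomputable instance : NormedSpace ℂ (FreeModule K N n) :=
  inferInstanceAs (NormedSpace ℂ C(K, EuclideanSpace ℂ (Word N n)))

instance : CompleteSpace (FreeModule K N n) :=
  inferInstanceAs (CompleteSpace C(K, EuclideanSpace ℂ (Word N n)))

instance : FunLike (FreeModule K N n) K (EuclideanSpace ℂ (Word N n)) :=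
  inferInstanceAs (FunLike C(K, EuclideanSpace ℂ (Word N n)) K (EuclideanSpace ℂ (Word N n)))

instance : ContinuousMapClass (FreeModule K N n) K (EuclideanSpace ℂ (Word N n)) :=
  inferInstanceAs
    (ContinuousMapClass C(K, EuclideanSpace ℂ (Word N n)) K (EuclideanSpace ℂ (Word N n)))

/-- A continuous family of vectors as an element of the free module. -/
def mk (f : K → EuclideanSpace ℂ (Word N n)) (hf : Continuous f) : FreeModule K N n :=
  (⟨f, hf⟩ : C(K, EuclideanSpace ℂ (Word N n)))

@[simp] theorem mk_apply (f : K → EuclideanSpace ℂ (Word N n)) (hf : Continuous f) (y : K) :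
    mk f hf y = f y := rfl

@[simp] theorem zero_apply (y : K) : (0 : FreeModule K N n) y = 0 := rfl

@[simp] theorem add_apply (f g : FreeModule K N n) (y : K) : (f + g) y = f y + g y := rfl

@[simp] theorem smul_apply (c : ℂ) (f : FreeModule K N n) (y : K) : (c • f) y = c • f y := rfl

@[ext] theorem ext {f g : FreeModule K N n} (h : ∀ y w, f y w = g y w) : f = g :=
  DFunLike.ext _ _ fun y => by ext w; exact h y w

theorem norm_le {f : FreeModule K N n} {C : ℝ} (hC : 0 ≤ C) : ‖f‖ ≤ C ↔ ∀ y, ‖f y‖ ≤ C :=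
  ContinuousMap.norm_le (f := (f : C(K, EuclideanSpace ℂ (Word N n)))) hC

theorem norm_apply_le (f : FreeModule K N n) (y : K) : ‖f y‖ ≤ ‖f‖ :=
  ContinuousMap.norm_coe_le_norm (f : C(K, EuclideanSpace ℂ (Word N n))) y

/-- The right action `(f · a)(y) = f(y) a(y)` of `A = C(K)`. -/
noncomputable def rsmul (f : FreeModule K N n) (a : C(K, ℂ)) : FreeModule K N n :=
  mk (fun y => a y • f y) (by fun_prop)

/-- The `A`-valued inner product `(f|g)_A(y) = ∑_w conj (f_w(y)) g_w(y)`. -/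
noncomputable def innerA (f g : FreeModule K N n) : C(K, ℂ) :=
  ⟨fun y => inner ℂ (f y) (g y), by fun_prop⟩

theorem norm_innerA_self (f : FreeModule K N n) : ‖f.innerA f‖ = ‖f‖ ^ 2 := by
  refine le_antisymm ?_ ?_
  · refine (ContinuousMap.norm_le _ (by positivity)).2 fun y => ?_
    have : ‖f.innerA f y‖ = ‖f y‖ ^ 2 := by simp [innerA, inner_self_eq_norm_sq_to_K]
    rw [this]
    gcongr
    exact f.norm_apply_le y
  · have h : ‖f‖ ≤ √‖f.innerA f‖ := (norm_le (by positivity)).2 fun y => by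
      refine Real.le_sqrt_of_sq_le ?_
      have : ‖f.innerA f y‖ = ‖f y‖ ^ 2 := by simp [innerA, inner_self_eq_norm_sq_to_K]
      rw [← this]
      exact ContinuousMap.norm_coe_le_norm _ y
    calc ‖f‖ ^ 2 ≤ √‖f.innerA f‖ ^ 2 := by gcongr
      _ = _ := Real.sq_sqrt (norm_nonneg _)

theorem continuous_eval : Continuous fun z : FreeModule K N n × K => z.1 z.2 :=
  (ContinuousEval.continuous_eval :
    Continuous fun z : C(K, EuclideanSpace ℂ (Word N n)) × K => z.1 z.2)

theorem continuous_of_uncurry {E : Type*} [TopologicalSpace E] (F : E → FreeModule K N n)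
    (hF : Continuous fun z : E × K => F z.1 z.2) : Continuous F :=
  ContinuousMap.continuous_of_continuous_uncurry
    (F : E → C(K, EuclideanSpace ℂ (Word N n))) hF

@[fun_prop]
theorem continuous_eval_comp {E : Type*} [TopologicalSpace E] {f : E → FreeModule K N n}
    {g : E → K} (hf : Continuous f) (hg : Continuous g) : Continuous fun e => f e (g e) :=
  continuous_eval.comp (hf.prodMk hg)

theorem mem_closure_map {E F : Type*} [NormedAddCommGroup E] [NormedSpace ℂ E]
    [NormedAddCommGroup F] [NormedSpace ℂ F] {s : Set E} (L : E →L[ℂ] F) (W : Submodule ℂ F)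
    (hW : IsClosed (W : Set F)) (h : ∀ g ∈ s, L g ∈ W) {f : E}
    (hf : f ∈ (Submodule.span ℂ s).topologicalClosure) : L f ∈ W := by
  have h1 : Submodule.span ℂ s ≤ W.comap (L : E →ₗ[ℂ] F) := Submodule.span_le.2 h
  exact Submodule.topologicalClosure_minimal _ h1 (hW.preimage L.continuous) hf

end FreeModule

/-- `M_{N^n}(A) = C(K, M_{N^n}(ℂ)) = L(Y_γ^{⊗ n})`. -/
abbrev MatrixFunction (K : Type*) [TopologicalSpace K] (N n : ℕ) : Type _ :=
  C(K, Matrix (Word N n) (Word N n) ℂ)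

/-- The cograph `{(γ_j(y), y)}` of `γ`. -/
def cograph (γ : Fin N → C(K, K)) : Set (K × K) := {z | ∃ j y, z = (γ j y, y)}

/-- The point `(γ_j(y), y)` of the cograph. -/
def cographPt (γ : Fin N → C(K, K)) (j : Fin N) (y : K) : cograph γ := ⟨(γ j y, y), j, y, rfl⟩

/-- The correspondence `X_γ`, as the space of continuous functions on the cograph. -/
abbrev XModule (γ : Fin N → C(K, K)) : Type _ := C(cograph γ, ℂ)

@[fun_prop]
theorem continuous_cographPt (γ : Fin N → C(K, K)) (j : Fin N) : Continuous (cographPt γ j) := by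
  unfold cographPt
  fun_prop

/-- The tensor `ξ ⊗ x` of `ξ ∈ Y_γ^{⊗ n}` with `x ∈ X_γ`, an element of `Y_γ^{⊗ (n+1)}`:
`(ξ ⊗ x)_{(i_1, …, i_{n+1})}(y) = ξ_{(i_2, …, i_{n+1})}(γ_{i_1}(y)) x(γ_{i_1}(y), y)`. -/
noncomputable def tensorStep (γ : Fin N → C(K, K)) {n : ℕ} (ξ : FreeModule K N n) (x : XModule γ) :
    FreeModule K N (n + 1) :=
  .mk (fun y => WithLp.toLp 2 fun w => ξ (γ (w 0) y) (Fin.tail w) * x (cographPt γ (w 0) y))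
    (by fun_prop)

/-- The defining inner product of the inner tensor product:
`(ξ ⊗ x | ξ' ⊗ x')_A = (x | φ((ξ|ξ')_A) x')_A`, where
`(x | φ(a) x')_A(y) = ∑_j conj (x(γ_j(y), y)) a(γ_j(y)) x'(γ_j(y), y)`. -/
theorem innerA_tensorStep (γ : Fin N → C(K, K)) {n : ℕ} (ξ ξ' : FreeModule K N n)
    (x x' : XModule γ) (y : K) :
    (tensorStep γ ξ x).innerA (tensorStep γ ξ' x') y =
      ∑ j, star (x (cographPt γ j y)) * ξ.innerA ξ' (γ j y) * x' (cographPt γ j y) := by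
  simp only [FreeModule.innerA, tensorStep, ContinuousMap.coe_mk, PiLp.inner_apply,
    RCLike.inner_apply, FreeModule.mk_apply]
  rw [← (Fin.consEquiv fun _ : Fin (n + 1) => Fin N).sum_comp, Fintype.sum_prod_type]
  refine Finset.sum_congr rfl fun j _ => ?_
  rw [Finset.mul_sum, Finset.sum_mul]
  refine Finset.sum_congr rfl fun w _ => ?_
  simp [Fin.consEquiv, Fin.tail_cons]
  ring

/-- The `n`-fold inner tensor product `X_γ^{⊗ n}`, realised isometrically inside `Y_γ^{⊗ n}`:
`X_γ^{⊗ 0} = A`, and `X_γ^{⊗ (n+1)} = X_γ^{⊗ n} ⊗_A X_γ` is the closed linear span of the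
tensors `ξ ⊗ x`, which satisfy `ξ a ⊗ x = ξ ⊗ φ(a) x` and whose inner products are the ones that
define the inner tensor product (`innerA_tensorStep`).  The inclusion into `Y_γ^{⊗ n}` is the map `φ(f)(y) = (f(γ_w(y), y))_w`. -/
noncomputable def tensorPower (γ : Fin N → C(K, K)) : (n : ℕ) → Submodule ℂ (FreeModule K N n)
  | 0 => ⊤
  | n + 1 => (Submodule.span ℂ
      {f | ∃ ξ ∈ tensorPower γ n, ∃ x : XModule γ, f = tensorStep γ ξ x}).topologicalClosure

theorem isClosed_tensorPower (γ : Fin N → C(K, K)) (n : ℕ) :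
    IsClosed (tensorPower γ n : Set (FreeModule K N n)) := by
  cases n with
  | zero => exact isClosed_univ
  | succ n => exact Submodule.isClosed_topologicalClosure _

theorem tensorStep_mem (γ : Fin N → C(K, K)) {n : ℕ} {ξ : FreeModule K N n}
    (hξ : ξ ∈ tensorPower γ n) (x : XModule γ) : tensorStep γ ξ x ∈ tensorPower γ (n + 1) :=
  Submodule.le_topologicalClosure _ (Submodule.subset_span ⟨ξ, hξ, x, rfl⟩)

/-- `X_γ^{⊗ n}` is a right `A`-submodule. -/
theorem rsmul_mem_tensorPower (γ : Fin N → C(K, K)) {n : ℕ} {f : FreeModule K N n}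
    (hf : f ∈ tensorPower γ n) (a : C(K, ℂ)) : f.rsmul a ∈ tensorPower γ n := by
  cases n with
  | zero => trivial
  | succ n =>
    let L : FreeModule K N (n + 1) →L[ℂ] FreeModule K N (n + 1) :=
      { toFun := fun f => f.rsmul a
        map_add' := fun f g => by ext y w; simp [FreeModule.rsmul]
        map_smul' := fun c f => by ext y w; simp [FreeModule.rsmul, mul_left_comm]
        cont := FreeModule.continuous_of_uncurry _ (by
          simp only [FreeModule.rsmul, FreeModule.mk_apply]
          fun_prop) }
    refine FreeModule.mem_closure_map L _ (isClosed_tensorPower γ _) ?_ hf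
    rintro _ ⟨ξ, hξ, x, rfl⟩
    convert tensorStep_mem γ hξ ((a.comp ⟨fun z : cograph γ => z.1.2, by fun_prop⟩) * x) using 1
    ext y w
    simp [L, FreeModule.rsmul, tensorStep, cographPt]
    ring

variable {p q n : ℕ}

/-- The tensor `ξ ⊗ η` of `ξ ∈ Y_γ^{⊗ q}` with `η ∈ Y_γ^{⊗ p}`, where `p + q = n`:
`(ξ ⊗ η)_{(i_1, …, i_n)}(y) = ξ_{(i_{p+1}, …, i_n)}(γ_{i_p} ∘ ⋯ ∘ γ_{i_1}(y)) η_{(i_1, …, i_p)}(y)`.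
-/
noncomputable def tensorMul (γ : Fin N → C(K, K)) (hn : p + q = n) (ξ : FreeModule K N q)
    (η : FreeModule K N p) : FreeModule K N n :=
  .mk (fun y => WithLp.toLp 2 fun w =>
    ξ (wordMap γ p (wordPre hn w) y) (wordSuf hn w) * η y (wordPre hn w)) (by fun_prop)

/-- `ξ ⊗ η` as a linear map in `η`. -/
noncomputable def tensorMulRight (γ : Fin N → C(K, K)) (hn : p + q = n) (ξ : FreeModule K N q) :
    FreeModule K N p →L[ℂ] FreeModule K N n where
  toFun := tensorMul γ hn ξ
  map_add' η η' := by ext y w; simp [tensorMul, mul_add]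
  map_smul' c η := by ext y w; simp [tensorMul, mul_left_comm]
  cont := FreeModule.continuous_of_uncurry _ (by
    simp only [tensorMul, FreeModule.mk_apply]
    fun_prop)

theorem tensorMul_tensorStep (γ : Fin N → C(K, K)) (hn : p + q = n) (hn' : p + 1 + q = n + 1)
    (ξ : FreeModule K N q) (η : FreeModule K N p) (x : XModule γ) :
    tensorMul γ hn' ξ (tensorStep γ η x) = tensorStep γ (tensorMul γ hn ξ η) x := by
  ext y w
  have h1 : wordSuf hn' w = wordSuf hn (Fin.tail w) := by
    funext k
    simp only [wordSuf, Fin.tail]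
    congr 1
    ext
    simp
    omega
  have h2 : Fin.tail (wordPre hn' w) = wordPre hn (Fin.tail w) := rfl
  have h3 : wordPre hn' w 0 = w 0 := rfl
  simp [tensorMul, tensorStep, wordMap, h1, h2, h3, mul_assoc]

theorem tensorMul_zero_right (γ : Fin N → C(K, K)) (hn : 0 + n = n) (ξ : FreeModule K N n)
    (η : FreeModule K N 0) :
    tensorMul γ hn ξ η = ξ.rsmul ⟨fun y => η y Fin.elim0, by fun_prop⟩ := by
  ext y w
  have h1 : wordSuf hn w = w := by
    funext k
    simp [wordSuf]
  have h2 : wordPre hn w = Fin.elim0 := Subsingleton.elim _ _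
  simp [tensorMul, FreeModule.rsmul, wordMap, h1, h2, mul_comm]

theorem tensorMul_mem (γ : Fin N → C(K, K)) (hn : p + q = n) {ξ : FreeModule K N q}
    {η : FreeModule K N p} (hξ : ξ ∈ tensorPower γ q) (hη : η ∈ tensorPower γ p) :
    tensorMul γ hn ξ η ∈ tensorPower γ n := by
  induction p generalizing n with
  | zero =>
    obtain rfl : q = n := by omega
    rw [tensorMul_zero_right]
    exact rsmul_mem_tensorPower γ hξ _
  | succ p ih =>
    obtain ⟨m, rfl⟩ : ∃ m, n = m + 1 := ⟨p + q, by omega⟩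
    refine FreeModule.mem_closure_map (tensorMulRight γ hn ξ) _ (isClosed_tensorPower γ _) ?_ hη
    rintro _ ⟨η', hη', x, rfl⟩
    change tensorMul γ hn ξ (tensorStep γ η' x) ∈ _
    rw [tensorMul_tensorStep γ (by omega : p + q = m)]
    exact tensorStep_mem γ (ih _ hη') x

/-- The tensors `ξ ⊗ η` span a dense subspace, i.e. `X_γ^{⊗ n} = X_γ^{⊗ q} ⊗_A X_γ^{⊗ p}`. -/
theorem tensorPower_le_closure (γ : Fin N → C(K, K)) (hn : p + q = n) :
    tensorPower γ n ≤ (Submodule.span ℂ {f | ∃ ξ ∈ tensorPower γ q, ∃ η ∈ tensorPower γ p,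
      f = tensorMul γ hn ξ η}).topologicalClosure := by
  induction p generalizing n with
  | zero =>
    obtain rfl : q = n := by omega
    refine fun f hf => Submodule.le_topologicalClosure _ (Submodule.subset_span
      ⟨f, hf, .mk (fun _ => WithLp.toLp 2 fun _ => 1) (by fun_prop), trivial, ?_⟩)
    rw [tensorMul_zero_right]
    ext y w
    simp [FreeModule.rsmul]
  | succ p ih =>
    obtain ⟨m, rfl⟩ : ∃ m, n = m + 1 := ⟨p + q, by omega⟩
    refine Submodule.topologicalClosure_minimal _ (Submodule.span_le.2 ?_)
      (Submodule.isClosed_topologicalClosure _)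
    rintro _ ⟨ζ, hζ, x, rfl⟩
    let L : FreeModule K N m →L[ℂ] FreeModule K N (m + 1) :=
      { toFun := fun ξ => tensorStep γ ξ x
        map_add' := fun f g => by ext y w; simp [tensorStep, add_mul]
        map_smul' := fun c f => by ext y w; simp [tensorStep, mul_assoc]
        cont := FreeModule.continuous_of_uncurry _ (by
          simp only [tensorStep, FreeModule.mk_apply]
          fun_prop) }
    refine FreeModule.mem_closure_map L _ (Submodule.isClosed_topologicalClosure _) ?_
      (ih (by omega : p + q = m) hζ)
    rintro _ ⟨ξ, hξ, η, hη, rfl⟩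
    exact Submodule.le_topologicalClosure _ (Submodule.subset_span
      ⟨ξ, hξ, tensorStep γ η x, tensorStep_mem γ hη x, (tensorMul_tensorStep γ _ hn ξ η x).symm⟩)

/-- The rank one operator `θ_{x,y}(z) = x (y|z)_A` on `X_γ^{⊗ n}`. -/
noncomputable def rankOne (γ : Fin N → C(K, K)) (x y : tensorPower γ n) :
    tensorPower γ n →L[ℂ] tensorPower γ n where
  toFun z := ⟨x.1.rsmul (y.1.innerA z.1), rsmul_mem_tensorPower γ x.2 _⟩
  map_add' z z' := by
    ext t w
    simp [FreeModule.rsmul, FreeModule.innerA, add_mul]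
  map_smul' c z := by
    ext t w
    simp [FreeModule.rsmul, FreeModule.innerA, mul_assoc]
  cont := by
    refine Continuous.subtype_mk (FreeModule.continuous_of_uncurry _ ?_) _
    simp only [FreeModule.rsmul, FreeModule.innerA, FreeModule.mk_apply, ContinuousMap.coe_mk]
    fun_prop

/-- The compact operators `K(X_γ^{⊗ n})`: the norm closure of the finite sums of rank one
operators. -/
noncomputable def compactOps (γ : Fin N → C(K, K)) (n : ℕ) :
    Submodule ℂ (tensorPower γ n →L[ℂ] tensorPower γ n) :=
  (Submodule.span ℂ {T | ∃ x y : tensorPower γ n, T = rankOne γ x y}).topologicalClosure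

/-- `S = T ⊗ I_p` on `X_γ^{⊗ n} = X_γ^{⊗ q} ⊗_A X_γ^{⊗ p}`: `S (ξ ⊗ η) = T ξ ⊗ η`. -/
def IsTensorId (γ : Fin N → C(K, K)) (hn : p + q = n) (T : tensorPower γ q →L[ℂ] tensorPower γ q)
    (S : tensorPower γ n →L[ℂ] tensorPower γ n) : Prop :=
  ∀ (ξ : tensorPower γ q) (η : tensorPower γ p),
    S ⟨tensorMul γ hn ξ.1 η.1, tensorMul_mem γ hn ξ.2 η.2⟩ =
      ⟨tensorMul γ hn (T ξ).1 η.1, tensorMul_mem γ hn (T ξ).2 η.2⟩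

/-- `K(X_γ^{⊗ q}) ⊗ I_p`, as a subspace of `L(X_γ^{⊗ n})`, where `p + q = n`. -/
noncomputable def compactOpsTensorId (γ : Fin N → C(K, K)) (hn : p + q = n) :
    Submodule ℂ (tensorPower γ n →L[ℂ] tensorPower γ n) where
  carrier := {S | ∃ T ∈ compactOps γ q, IsTensorId γ hn T S}
  zero_mem' := ⟨0, zero_mem _, fun ξ η => by ext y w; simp [tensorMul]⟩
  add_mem' := by
    rintro S S' ⟨T, hT, hS⟩ ⟨T', hT', hS'⟩
    refine ⟨T + T', add_mem hT hT', fun ξ η => ?_⟩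
    rw [_root_.add_apply, hS, hS']
    ext y w
    simp [tensorMul, add_mul]
  smul_mem' := by
    rintro c S ⟨T, hT, hS⟩
    refine ⟨c • T, Submodule.smul_mem _ c hT, fun ξ η => ?_⟩
    rw [_root_.smul_apply, hS]
    ext y w
    simp [tensorMul, mul_assoc]

/-- The finite core `F^{(n)} = A ⊗ I + K(X_γ) ⊗ I + ⋯ + K(X_γ^{⊗ n}) ⊆ L(X_γ^{⊗ n})`. -/
noncomputable def finiteCore (γ : Fin N → C(K, K)) (n : ℕ) :
    Submodule ℂ (tensorPower γ n →L[ℂ] tensorPower γ n) :=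
  ⨆ q : Fin (n + 1), compactOpsTensorId γ (by omega : (n - q) + q = n)

end Modules

section Matrices

variable {K : Type*} [MetricSpace K] [CompactSpace K] {N p q n : ℕ}

/-- `π_{q,u}(A)`: the block matrix with `A` in the diagonal block labelled by `u ∈ Σ^p` and with
all other blocks zero. -/
def blockEmb (hn : p + q = n) (u : Word N p) :
    Matrix (Word N q) (Word N q) ℂ →ₗ[ℂ] Matrix (Word N n) (Word N n) ℂ where
  toFun A := Matrix.of fun w w' =>
    if wordPre hn w = u ∧ wordPre hn w' = u then A (wordSuf hn w) (wordSuf hn w') else 0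
  map_add' A B := by ext w w'; simp only [Matrix.of_apply, Matrix.add_apply]; split_ifs <;> simp
  map_smul' c A := by ext w w'; simp

theorem continuous_blockEmb (hn : p + q = n) (u : Word N p) :
    Continuous (blockEmb hn u) := by
  refine continuous_matrix fun w w' => ?_
  simp only [blockEmb, LinearMap.coe_mk, AddHom.coe_mk, Matrix.of_apply]
  split_ifs <;> fun_prop

/-- The matrix form of `M ⊗ I_p`:
`(M ⊗ I_p)(y) = ∑_{u = (i_1, …, i_p)} π_{q,u} (M(γ_{i_p} ∘ ⋯ ∘ γ_{i_1}(y)))`. -/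
noncomputable def matTensorId (γ : Fin N → C(K, K)) (hn : p + q = n) (M : MatrixFunction K N q) :
    MatrixFunction K N n :=
  ⟨fun y => ∑ u : Word N p, blockEmb hn u (M (wordMap γ p u y)), by
    have := fun u : Word N p => continuous_blockEmb hn u
    fun_prop⟩

/-- The rank one operator `θ_{x,y} = [x_w conj(y_{w'})]_{w,w'}` on `Y_γ^{⊗ n}`. -/
noncomputable def rankOneMat (x y : FreeModule K N n) : MatrixFunction K N n :=
  ⟨fun t => Matrix.of fun w w' => x t w * star (y t w'), by fun_prop⟩

/-- `K(Z ⊆ Y)` for `Z = X_γ^{⊗ n} ⊆ Y = Y_γ^{⊗ n}`: the closure of the finite sums of the rank one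
operators `θ^Y_{x,y}` with `x, y ∈ Z`. -/
noncomputable def compactMats (γ : Fin N → C(K, K)) (n : ℕ) : Submodule ℂ (MatrixFunction K N n) :=
  (Submodule.span ℂ {M | ∃ x ∈ tensorPower γ n, ∃ y ∈ tensorPower γ n,
    M = rankOneMat x y}).topologicalClosure

/-- The action of `M_{N^n}(A)` on `A^{N^n}`. -/
noncomputable def applyMat (M : MatrixFunction K N n) : FreeModule K N n →L[ℂ] FreeModule K N n where
  toFun f := .mk (fun y => WithLp.toLp 2 (Matrix.mulVec (M y) (f y))) (by fun_prop)
  map_add' f g := by ext y w; simp [Matrix.mulVec_add]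
  map_smul' c f := by ext y w; simp [Matrix.mulVec_smul]
  cont := FreeModule.continuous_of_uncurry _ (by
    simp only [FreeModule.mk_apply]
    fun_prop)

theorem applyMat_apply (M : MatrixFunction K N n) (f : FreeModule K N n) (y : K) :
    applyMat M f y = WithLp.toLp 2 (Matrix.mulVec (M y) (f y)) := rfl

theorem applyMat_rankOneMat (x y z : FreeModule K N n) :
    applyMat (rankOneMat x y) z = x.rsmul (y.innerA z) := by
  ext t w
  simp only [applyMat_apply, rankOneMat, ContinuousMap.coe_mk, Matrix.mulVec, dotProduct,
    Matrix.of_apply, FreeModule.rsmul, FreeModule.mk_apply, FreeModule.innerA, PiLp.smul_apply,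
    smul_eq_mul, PiLp.inner_apply, RCLike.inner_apply, Finset.sum_mul]
  refine Finset.sum_congr rfl fun i _ => ?_
  simp
  ring

/-- Splitting a word after its first `p` letters. -/
def wordEquiv (hn : p + q = n) : Word N n ≃ Word N p × Word N q where
  toFun w := (wordPre hn w, wordSuf hn w)
  invFun z := fun k => if h : k.1 < p then z.1 ⟨k, h⟩ else z.2 ⟨k - p, by omega⟩
  left_inv w := by
    funext k
    by_cases h : k.1 < p
    · simp [wordPre, h]
    · simp [wordSuf, h, show p + (k.1 - p) = k.1 by omega]
  right_inv z := by
    ext k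
    · simp [wordPre]
    · simp [wordSuf]

theorem applyMat_matTensorId (γ : Fin N → C(K, K)) (hn : p + q = n) (M : MatrixFunction K N q)
    (ξ : FreeModule K N q) (η : FreeModule K N p) :
    applyMat (matTensorId γ hn M) (tensorMul γ hn ξ η) = tensorMul γ hn (applyMat M ξ) η := by
  ext y w
  simp only [applyMat_apply, matTensorId, tensorMul, ContinuousMap.coe_mk, FreeModule.mk_apply,
    Matrix.mulVec, dotProduct, Matrix.sum_apply, blockEmb, LinearMap.coe_mk, AddHom.coe_mk,
    Matrix.of_apply]
  rw [← (wordEquiv hn).symm.sum_comp, Fintype.sum_prod_type]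
  have h1 : ∀ z : Word N p × Word N q, wordPre hn ((wordEquiv hn).symm z) = z.1 := fun z =>
    congrArg Prod.fst ((wordEquiv hn).apply_symm_apply z)
  have h2 : ∀ z : Word N p × Word N q, wordSuf hn ((wordEquiv hn).symm z) = z.2 := fun z =>
    congrArg Prod.snd ((wordEquiv hn).apply_symm_apply z)
  simp only [h1, h2]
  rw [Fintype.sum_eq_single (wordPre hn w)]
  · rw [Finset.sum_mul]
    exact Finset.sum_congr rfl fun v _ => by simp [mul_assoc]
  · intro u hu
    refine Finset.sum_eq_zero fun v _ => ?_
    rw [Finset.sum_eq_zero, zero_mul]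
    intro i _
    rw [if_neg]
    rintro ⟨rfl, h⟩
    exact hu h

open scoped Matrix.Norms.L2Operator in
theorem norm_applyMat_le (M : MatrixFunction K N n) (f : FreeModule K N n) :
    ‖applyMat M f‖ ≤ ‖M‖ * ‖f‖ := by
  refine (FreeModule.norm_le (by positivity)).2 fun y => ?_
  refine (Matrix.l2_opNorm_mulVec (M y) (f y)).trans ?_
  gcongr
  · exact M.norm_coe_le_norm y
  · exact f.norm_apply_le y

/-- `applyMat` as a linear map in the matrix. -/
noncomputable def applyMatL (f : FreeModule K N n) :
    MatrixFunction K N n →L[ℂ] FreeModule K N n where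
  toFun M := applyMat M f
  map_add' M M' := by ext y w; simp [applyMat_apply, Matrix.add_mulVec]
  map_smul' c M := by ext y w; simp [applyMat_apply, Matrix.smul_mulVec]
  cont := FreeModule.continuous_of_uncurry _ (by
    simp only [applyMat_apply]
    fun_prop)

open scoped Matrix.Norms.L2Operator in
theorem applyMat_mem (γ : Fin N → C(K, K)) {M : MatrixFunction K N n}
    (hM : M ∈ compactMats γ n) (f : FreeModule K N n) : applyMat M f ∈ tensorPower γ n := by
  refine FreeModule.mem_closure_map (applyMatL f) _ (isClosed_tensorPower γ n) ?_ hM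
  rintro _ ⟨x, hx, y, hy, rfl⟩
  change applyMat _ _ ∈ _
  rw [applyMat_rankOneMat]
  exact rsmul_mem_tensorPower γ hx _

/-- The restriction `δ(M)` of `M ∈ K(Z ⊆ Y)` to `Z = X_γ^{⊗ n}`. -/
noncomputable def restrictMat (γ : Fin N → C(K, K)) (n : ℕ) :
    compactMats γ n →ₗ[ℂ] (tensorPower γ n →L[ℂ] tensorPower γ n) where
  toFun M := ((applyMat M.1).comp (tensorPower γ n).subtypeL).codRestrict (tensorPower γ n)
    (fun z => applyMat_mem γ M.2 z.1)
  map_add' M M' := by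
    ext1 z
    exact Subtype.ext (map_add (applyMatL z.1) M.1 M'.1)
  map_smul' c M := by
    ext1 z
    exact Subtype.ext (map_smul (applyMatL z.1) c M.1)

theorem restrictMat_apply (γ : Fin N → C(K, K)) (M : compactMats γ n) (z : tensorPower γ n) :
    (restrictMat γ n M z : FreeModule K N n) = applyMat M.1 z.1 := rfl

open scoped Matrix.Norms.L2Operator in
theorem norm_restrictMat_le (γ : Fin N → C(K, K)) (M : compactMats γ n) :
    ‖restrictMat γ n M‖ ≤ ‖M.1‖ :=
  ContinuousLinearMap.opNorm_le_bound _ (norm_nonneg M.1) fun z => norm_applyMat_le M.1 z.1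

open scoped Matrix.Norms.L2Operator in
theorem norm_star_matrixFunction_le (M : MatrixFunction K N n) : ‖star M‖ ≤ ‖M‖ := by
  refine (ContinuousMap.norm_le _ (norm_nonneg M)).2 fun y => ?_
  refine le_trans (le_of_eq ?_) (M.norm_coe_le_norm y)
  exact Matrix.l2_opNorm_conjTranspose (M y)

open scoped Matrix.Norms.L2Operator in
theorem norm_mul_self_le (M : MatrixFunction K N n) : ‖M‖ * ‖M‖ ≤ ‖M * star M‖ := by
  have h : ‖M‖ ≤ √‖M * star M‖ := (ContinuousMap.norm_le _ (by positivity)).2 fun y => by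
    refine Real.le_sqrt_of_sq_le ?_
    refine le_trans (le_of_eq ?_) ((M * star M).norm_coe_le_norm y)
    rw [pow_two]
    exact CStarRing.norm_self_mul_star.symm
  calc ‖M‖ * ‖M‖ ≤ √‖M * star M‖ * √‖M * star M‖ := by gcongr
    _ = _ := Real.mul_self_sqrt (norm_nonneg _)

open scoped Matrix.Norms.L2Operator in
theorem star_mem_compactMats (γ : Fin N → C(K, K)) {M : MatrixFunction K N n}
    (hM : M ∈ compactMats γ n) : star M ∈ compactMats γ n := by
  refine map_mem_closure continuous_star hM fun M hM => ?_
  refine Submodule.span_induction (p := fun M _ => star M ∈ Submodule.span ℂ _) ?_ ?_ ?_ ?_ hM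
  · rintro _ ⟨x, hx, y, hy, rfl⟩
    refine Submodule.subset_span ⟨y, hy, x, hx, ?_⟩
    ext t w w'
    simp [rankOneMat, Matrix.star_apply, mul_comm]
  · simp
  · intro a b _ _ ha hb
    rw [star_add]
    exact add_mem ha hb
  · intro c a _ ha
    rw [star_smul]
    exact Submodule.smul_mem _ _ ha

open scoped Matrix.Norms.L2Operator in
theorem norm_le_norm_restrictMat (γ : Fin N → C(K, K)) (M : compactMats γ n) :
    ‖M.1‖ ≤ ‖restrictMat γ n M‖ := by
  have h1 : ‖M.1 * star M.1‖ ≤ ‖restrictMat γ n M‖ * ‖M.1‖ := by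
    refine (ContinuousMap.norm_le _ (by positivity)).2 fun y => ?_
    rw [Matrix.l2_opNorm_def]
    refine ContinuousLinearMap.opNorm_le_bound _ (by positivity) fun v => ?_
    let f : FreeModule K N n := .mk (fun _ => v) continuous_const
    have hf : ‖f‖ ≤ ‖v‖ := (FreeModule.norm_le (norm_nonneg _)).2 fun _ => le_rfl
    let z : tensorPower γ n := ⟨applyMat (star M.1) f, applyMat_mem γ (star_mem_compactMats γ M.2) f⟩
    have hz : ‖z‖ ≤ ‖M.1‖ * ‖v‖ := (norm_applyMat_le (star M.1) f).trans
      (mul_le_mul (norm_star_matrixFunction_le M.1) hf (norm_nonneg _) (norm_nonneg _))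
    have h2 : ‖restrictMat γ n M z‖ ≤ ‖restrictMat γ n M‖ * (‖M.1‖ * ‖v‖) :=
      ((restrictMat γ n M).le_opNorm z).trans (by gcongr)
    rw [mul_assoc]
    refine le_trans ?_ (((restrictMat γ n M z).1.norm_apply_le y).trans h2)
    refine le_of_eq ?_
    congr 1
    ext w
    simp [restrictMat_apply, applyMat_apply, z, f, Matrix.mulVec_mulVec]
  have h2 := (norm_mul_self_le M.1).trans h1
  by_contra! hlt
  have : 0 < ‖M.1‖ := (norm_nonneg (restrictMat γ n M)).trans_lt hlt
  nlinarith

theorem restrictMat_rankOneMat (γ : Fin N → C(K, K)) (x y : tensorPower γ n)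
    (h : rankOneMat x.1 y.1 ∈ compactMats γ n) :
    restrictMat γ n ⟨rankOneMat x.1 y.1, h⟩ = rankOne γ x y := by
  ext1 z
  exact Subtype.ext (applyMat_rankOneMat x.1 y.1 z.1)

open scoped Matrix.Norms.L2Operator in
theorem isometry_restrictMat (γ : Fin N → C(K, K)) (n : ℕ) : Isometry (restrictMat γ n) :=
  Isometry.of_dist_eq fun M M' => by
    rw [dist_eq_norm, ← map_sub]
    refine (le_antisymm (norm_restrictMat_le γ _) (norm_le_norm_restrictMat γ _)).trans ?_
    exact (dist_eq_norm M.1 M'.1).symm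

open scoped Matrix.Norms.L2Operator in
theorem restrictMat_mem (γ : Fin N → C(K, K)) (M : compactMats γ n) :
    restrictMat γ n M ∈ compactOps γ n := by
  have hcl : IsClosed (compactMats γ n : Set (MatrixFunction K N n)) :=
    Submodule.isClosed_topologicalClosure _
  have hW : IsClosed
      (((compactOps γ n).comap (restrictMat γ n)).map (compactMats γ n).subtype :
        Set (MatrixFunction K N n)) := by
    rw [Submodule.map_coe]
    refine hcl.isClosedEmbedding_subtypeVal.isClosedMap _ ?_
    exact (Submodule.isClosed_topologicalClosure _).preimage (isometry_restrictMat γ n).continuous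
  have h := Submodule.topologicalClosure_minimal (Submodule.span ℂ
    {M | ∃ x ∈ tensorPower γ n, ∃ y ∈ tensorPower γ n, M = rankOneMat x y})
    (Submodule.span_le.2 ?_) hW M.2
  · obtain ⟨M', hM', h2⟩ := h
    rwa [show M' = M from Subtype.ext h2] at hM'
  · rintro _ ⟨x, hx, y, hy, rfl⟩
    have hm : rankOneMat x y ∈ compactMats γ n :=
      Submodule.le_topologicalClosure _ (Submodule.subset_span ⟨x, hx, y, hy, rfl⟩)
    refine ⟨⟨_, hm⟩, ?_, rfl⟩
    change restrictMat γ n _ ∈ compactOps γ n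
    rw [restrictMat_rankOneMat γ ⟨x, hx⟩ ⟨y, hy⟩ hm]
    exact Submodule.le_topologicalClosure _ (Submodule.subset_span ⟨_, _, rfl⟩)

open scoped Matrix.Norms.L2Operator in
theorem bijective_restrictMat (γ : Fin N → C(K, K)) (n : ℕ) : Function.Bijective
    ((restrictMat γ n).codRestrict (compactOps γ n) (restrictMat_mem γ)) := by
  constructor
  · intro M M' h
    exact (isometry_restrictMat γ n).injective (congrArg Subtype.val h)
  · rintro ⟨T, hT⟩
    have hcomp : CompleteSpace (compactMats γ n) :=
      (Submodule.isClosed_topologicalClosure _).completeSpace_coe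
    have hcl : IsClosed (LinearMap.range (restrictMat γ n) : Set (tensorPower γ n →L[ℂ] tensorPower γ n)) := by
      rw [LinearMap.coe_range]
      exact (isometry_restrictMat γ n).isClosedEmbedding.isClosed_range
    have h := Submodule.topologicalClosure_minimal
      (Submodule.span ℂ {T | ∃ x y : tensorPower γ n, T = rankOne γ x y})
      (Submodule.span_le.2 ?_) hcl hT
    · obtain ⟨M, hM⟩ := h
      exact ⟨M, Subtype.ext hM⟩
    · rintro _ ⟨x, y, rfl⟩
      have hm : rankOneMat x.1 y.1 ∈ compactMats γ n :=
        Submodule.le_topologicalClosure _ (Submodule.subset_span ⟨x.1, x.2, y.1, y.2, rfl⟩)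
      exact ⟨⟨_, hm⟩, restrictMat_rankOneMat γ x y hm⟩

/-- The matrix representation `Ω^{(n)} : K(X_γ^{⊗ n}) → M_{N^n}(A)`, the inverse of the
restriction isomorphism `δ : K(Z ⊆ Y) → K(Z)`. -/
noncomputable def omega (γ : Fin N → C(K, K)) (n : ℕ) :
    compactOps γ n →ₗ[ℂ] MatrixFunction K N n :=
  (compactMats γ n).subtype ∘ₗ
    (LinearEquiv.ofBijective _ (bijective_restrictMat γ n)).symm.toLinearMap

theorem applyMat_omega (γ : Fin N → C(K, K)) (T : compactOps γ n) (z : tensorPower γ n) :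
    applyMat (omega γ n T) z.1 = (T.1 z).1 := by
  have h := (LinearEquiv.ofBijective _ (bijective_restrictMat γ n)).apply_symm_apply T
  have h2 := congrArg (fun S : compactOps γ n => (S.1 z).1) h
  exact h2

/-- `Ω^{(n)}(θ^X_{x,y}) = θ^Y_{φ(x),φ(y)}`. -/
theorem omega_rankOne (γ : Fin N → C(K, K)) (x y : tensorPower γ n)
    (h : rankOne γ x y ∈ compactOps γ n) :
    omega γ n ⟨rankOne γ x y, h⟩ = rankOneMat x.1 y.1 := by
  have hm : rankOneMat x.1 y.1 ∈ compactMats γ n :=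
    Submodule.le_topologicalClosure _ (Submodule.subset_span ⟨x.1, x.2, y.1, y.2, rfl⟩)
  have : (LinearEquiv.ofBijective _ (bijective_restrictMat γ n)).symm ⟨rankOne γ x y, h⟩ =
      ⟨rankOneMat x.1 y.1, hm⟩ := by
    rw [LinearEquiv.symm_apply_eq]
    exact Subtype.ext (restrictMat_rankOneMat γ x y hm).symm
  simp only [omega, LinearMap.comp_apply, LinearEquiv.coe_coe, this, Submodule.subtype_apply]

end Matrices

section Representation

variable {K : Type*} [MetricSpace K] [CompactSpace K] {N n : ℕ}

theorem neBot_nhdsWithin (γ : Fin N → C(K, K)) (h : K → K) (hγ : IsSelfSimilarMap γ)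
    (hB : AssumptionB γ h) (x : K) : (nhdsWithin x {x}ᶜ).NeBot := by
  have h0 : 0 < N := by have := hγ.two_le; omega
  have : Nonempty (Fin N) := ⟨⟨0, h0⟩⟩
  have h1 : 1 < N := by have := hγ.two_le; omega
  have hnt : ∃ a b : K, a ≠ b := by
    by_contra! hcon
    have hx : x ∈ branchSet γ :=
      ⟨x, ⟨0, h0⟩, ⟨1, h1⟩, by simp, hcon _ _, hcon _ _⟩
    have : x ∈ branchSet γ ∩ postcriticalSet γ :=
      ⟨hx, 1, le_rfl, fun _ => ⟨0, h0⟩, by rwa [hcon (wordMap γ 1 _ x) x]⟩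
    rw [hB.branchSet_inter] at this
    exact this
  choose c' c hc' hcc hc1 hd using hγ.contraction
  obtain ⟨i₀, hi₀⟩ := Finite.exists_max c
  have hpos : 0 ≤ c i₀ := ((hc' i₀).trans_le (hcc i₀)).le
  have hcontr : ∀ (k : ℕ) (w : Word N k) (a b : K),
      dist (wordMap γ k w a) (wordMap γ k w b) ≤ c i₀ ^ k * dist a b := by
    intro k
    induction k with
    | zero => intro w a b; simp [wordMap]
    | succ k ih =>
      intro w a b
      refine (ih _ _ _).trans ?_
      rw [pow_succ, mul_assoc]
      refine mul_le_mul_of_nonneg_left ?_ (by positivity)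
      exact ((hd (w 0) a b).2).trans (mul_le_mul_of_nonneg_right (hi₀ _) dist_nonneg)
  have hsurj : ∀ k : ℕ, ∃ (w : Word N k) (z : K), wordMap γ k w z = x := by
    intro k
    induction k with
    | zero => exact ⟨Fin.elim0, x, rfl⟩
    | succ k ih =>
      obtain ⟨w, z, hz⟩ := ih
      have : z ∈ ⋃ i, Set.range (γ i) := hγ.cover ▸ Set.mem_univ z
      obtain ⟨i, y, hy⟩ := Set.mem_iUnion.1 this
      exact ⟨Fin.cons i w, y, by simp [wordMap, hy, hz]⟩
  have hinj : ∀ (k : ℕ) (w : Word N k), Function.Injective (wordMap γ k w) := by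
    intro k
    induction k with
    | zero => intro w a b hab; exact hab
    | succ k ih =>
      intro w a b hab
      have := ih _ hab
      rw [← hB.left_inv (w 0) a, ← hB.left_inv (w 0) b, this]
  rw [Filter.neBot_iff, ne_eq, ← isOpen_singleton_iff_punctured_nhds]
  intro hopen
  obtain ⟨ε, hε, hball⟩ := Metric.isOpen_iff.1 hopen x rfl
  have hbd : Bornology.IsBounded (Set.univ : Set K) := Metric.isBounded_of_compactSpace
  set D := Metric.diam (Set.univ : Set K) with hDdef
  have hD0 : 0 ≤ D := Metric.diam_nonneg
  obtain ⟨k, hk⟩ := exists_pow_lt_of_lt_one (show 0 < ε / (D + 1) by positivity) (hc1 i₀)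
  obtain ⟨w, z, hz⟩ := hsurj k
  have hconst : ∀ a, a = z := by
    intro a
    apply hinj k w
    rw [hz]
    refine hball ?_
    rw [Metric.mem_ball, ← hz]
    calc _ ≤ c i₀ ^ k * dist a z := hcontr k w a z
      _ ≤ c i₀ ^ k * (D + 1) := by
        refine mul_le_mul_of_nonneg_left ?_ (by positivity)
        have := Metric.dist_le_diam_of_mem hbd (Set.mem_univ a) (Set.mem_univ z)
        linarith
      _ < ε := (lt_div_iff₀ (by positivity)).1 hk
  obtain ⟨a, b, hab⟩ := hnt
  exact hab ((hconst a).trans (hconst b).symm)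

theorem finite_collisions (γ : Fin N → C(K, K)) (h : K → K)
    (hB : AssumptionB γ h) (n : ℕ) :
    {y | ∃ w w' : Word N n, w ≠ w' ∧ wordMap γ n w y = wordMap γ n w' y}.Finite := by
  induction n with
  | zero =>
    refine Set.Finite.subset Set.finite_empty ?_
    rintro y ⟨w, w', hne, -⟩
    exact hne (Subsingleton.elim _ _)
  | succ n ih =>
    have hit : ∀ (n : ℕ) (w : Word N n) (y : K), h^[n] (wordMap γ n w y) = y := by
      intro n
      induction n with
      | zero => intro w y; rfl
      | succ n ih =>
        intro w y
        rw [Function.iterate_succ_apply']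
        exact (congrArg h (ih _ _)).trans (hB.left_inv _ _)
    refine ((hB.finite_branchSet.image h).union (ih.image h)).subset ?_
    rintro y ⟨w, w', hne, heq⟩
    have h1 : γ (w 0) y = γ (w' 0) y := by
      rw [← hit n (Fin.tail w) (γ (w 0) y), ← hit n (Fin.tail w') (γ (w' 0) y)]
      exact congrArg _ heq
    by_cases h0 : w 0 = w' 0
    · refine Or.inr ⟨γ (w 0) y, ⟨Fin.tail w, Fin.tail w', ?_, ?_⟩, hB.left_inv _ _⟩
      · intro ht
        apply hne
        rw [← Fin.cons_self_tail w, ← Fin.cons_self_tail w', h0, ht]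
      · simpa [wordMap, h0] using heq
    · exact Or.inl ⟨γ (w 0) y, ⟨y, w 0, w' 0, h0, rfl, h1⟩, hB.left_inv _ _⟩

/-- The left action of `f ∈ A` on the unit vector of `X_γ^{⊗ n}` lies in `X_γ^{⊗ n}`. -/
theorem pullback_mem (γ : Fin N → C(K, K)) (f : C(K, ℂ)) (n : ℕ) :
    FreeModule.mk (fun y => WithLp.toLp 2 fun w => f (wordMap γ n w y)) (by fun_prop) ∈
      tensorPower γ n := by
  induction n with
  | zero => trivial
  | succ n ih =>
    convert tensorStep_mem γ ih 1 using 1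
    ext y w
    simp [tensorStep, wordMap]

/-- Under Assumption B a matrix over `A` is determined by its action on `X_γ^{⊗ n}`. -/
theorem matrix_ext (γ : Fin N → C(K, K)) (h : K → K) (hγ : IsSelfSimilarMap γ)
    (hB : AssumptionB γ h) {M M' : MatrixFunction K N n}
    (hM : ∀ z ∈ tensorPower γ n, applyMat M z = applyMat M' z) : M = M' := by
  have hne := neBot_nhdsWithin γ h hγ hB
  have hdense : Dense {y | ∃ w w' : Word N n, w ≠ w' ∧ wordMap γ n w y = wordMap γ n w' y}ᶜ := by
    have := (dense_univ (X := K)).sdiff_finite (finite_collisions γ h hB n)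
    rwa [← Set.compl_eq_univ_sdiff] at this
  refine DFunLike.coe_injective (Continuous.ext_on hdense M.continuous M'.continuous ?_)
  intro y hy
  simp only [Set.mem_compl_iff, Set.mem_ofPred_eq, not_exists, not_and] at hy
  ext w w'
  let f : C(K, ℂ) := ⟨fun x => ∏ v ∈ Finset.univ.erase w', ((dist x (wordMap γ n v y) : ℝ) : ℂ),
    by fun_prop⟩
  have h1 := congrArg (fun g : FreeModule K N n => g y w) (hM _ (pullback_mem γ f n))
  have hf : ∀ v, v ≠ w' → f (wordMap γ n v y) = 0 := fun v hv =>
    Finset.prod_eq_zero (Finset.mem_erase.2 ⟨hv, Finset.mem_univ v⟩) (by simp)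
  have hf' : f (wordMap γ n w' y) ≠ 0 := by
    refine Finset.prod_ne_zero_iff.2 fun v hv => ?_
    simpa using hy w' v (Finset.ne_of_mem_erase hv).symm
  simp only [applyMat_apply, FreeModule.mk_apply, Matrix.mulVec, dotProduct] at h1
  rw [Finset.sum_eq_single w' (fun v _ hv => by rw [hf v hv, mul_zero]) (by simp),
    Finset.sum_eq_single w' (fun v _ hv => by rw [hf v hv, mul_zero]) (by simp)] at h1
  exact mul_right_cancel₀ hf' h1

/-- If `S = T ⊗ I` then `S` is given on `X_γ^{⊗ n}` by the matrix of `T`, tensored with `I`. -/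
theorem applyMat_of_isTensorId (γ : Fin N → C(K, K)) {p q : ℕ} (hn : p + q = n)
    (T : compactOps γ q) (S : tensorPower γ n →L[ℂ] tensorPower γ n)
    (hS : IsTensorId γ hn T.1 S) (z : tensorPower γ n) :
    applyMat (matTensorId γ hn (omega γ q T)) z.1 = (S z).1 := by
  let L₁ : tensorPower γ n →L[ℂ] FreeModule K N n :=
    (applyMat (matTensorId γ hn (omega γ q T))).comp (tensorPower γ n).subtypeL
  let L₂ : tensorPower γ n →L[ℂ] FreeModule K N n := (tensorPower γ n).subtypeL.comp S
  let W : Submodule ℂ (FreeModule K N n) :=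
    (LinearMap.eqLocus L₁.toLinearMap L₂.toLinearMap).map (tensorPower γ n).subtype
  have hW : IsClosed (W : Set (FreeModule K N n)) := by
    rw [Submodule.map_coe]
    refine (isClosed_tensorPower γ n).isClosedEmbedding_subtypeVal.isClosedMap _ ?_
    exact isClosed_eq L₁.continuous L₂.continuous
  have h := Submodule.topologicalClosure_minimal
    (Submodule.span ℂ {f | ∃ ξ ∈ tensorPower γ q, ∃ η ∈ tensorPower γ p, f = tensorMul γ hn ξ η})
    (t := W) (Submodule.span_le.2 ?_) hW (tensorPower_le_closure γ hn z.2)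
  · obtain ⟨z', hz', h2⟩ := h
    rw [show z = z' from (Subtype.ext h2).symm]
    exact hz'
  · rintro _ ⟨ξ, hξ, η, hη, rfl⟩
    refine ⟨⟨_, tensorMul_mem γ hn hξ hη⟩, ?_, rfl⟩
    change applyMat _ (tensorMul γ hn ξ η) = (S _).1
    rw [applyMat_matTensorId, hS ⟨ξ, hξ⟩ ⟨η, hη⟩, applyMat_omega γ T ⟨ξ, hξ⟩]

/-- Every operator in the finite core is given on `X_γ^{⊗ n}` by a matrix over `A`. -/
theorem exists_matrix (γ : Fin N → C(K, K)) (n : ℕ) (S : tensorPower γ n →L[ℂ] tensorPower γ n)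
    (hS : S ∈ finiteCore γ n) :
    ∃ M : MatrixFunction K N n, ∀ z : tensorPower γ n, applyMat M z.1 = (S z).1 := by
  refine Submodule.iSup_induction _ (motive := fun S => ∃ M : MatrixFunction K N n,
    ∀ z : tensorPower γ n, applyMat M z.1 = (S z).1) hS ?_ ?_ ?_
  · rintro q S ⟨T, hT, hS⟩
    exact ⟨_, applyMat_of_isTensorId γ _ ⟨T, hT⟩ S hS⟩
  · exact ⟨0, fun z => map_zero (applyMatL z.1)⟩
  · rintro S S' ⟨M, hM⟩ ⟨M', hM'⟩
    refine ⟨M + M', fun z => ?_⟩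
    refine (map_add (applyMatL z.1) M M').trans ?_
    exact congrArg₂ (· + ·) (hM z) (hM' z)

/-- Under Assumption B there is exactly one linear map `Π^{(n)} : F^{(n)} → M_{N^n}(A)` with
`Π^{(n)}(T ⊗ I_{n-q}) = Ω^{(q)}(T) ⊗ I_{n-q}` for all `T ∈ K(X_γ^{⊗ q})`, `0 ≤ q ≤ n`. -/
theorem existsUnique_matrixRep {γ : Fin N → C(K, K)} {h : K → K} (hγ : IsSelfSimilarMap γ)
    (hB : AssumptionB γ h) (n : ℕ) :
    ∃! Φ : finiteCore γ n →ₗ[ℂ] MatrixFunction K N n,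
      ∀ (q : Fin (n + 1)) (T : compactOps γ q) (S : finiteCore γ n),
        IsTensorId γ (by omega : (n - q) + q = n) T.1 S.1 →
          Φ S = matTensorId γ (by omega : (n - q) + q = n) (omega γ q T) := by
  choose Ψ hΨ using exists_matrix γ n
  have key : ∀ (S : finiteCore γ n) (M : MatrixFunction K N n),
      (∀ z : tensorPower γ n, applyMat M z.1 = (S.1 z).1) → Ψ S.1 S.2 = M := fun S M hM =>
    matrix_ext γ h hγ hB fun z hz => (hΨ S.1 S.2 ⟨z, hz⟩).trans (hM ⟨z, hz⟩).symm
  let Φ₀ : finiteCore γ n →ₗ[ℂ] MatrixFunction K N n :=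
    { toFun := fun S => Ψ S.1 S.2
      map_add' := fun S S' => by
        refine key _ _ fun z => ?_
        refine (map_add (applyMatL z.1) _ _).trans ?_
        exact congrArg₂ (· + ·) (hΨ S.1 S.2 z) (hΨ S'.1 S'.2 z)
      map_smul' := fun c S => by
        refine key _ _ fun z => ?_
        refine (map_smul (applyMatL z.1) c _).trans ?_
        exact congrArg (c • ·) (hΨ S.1 S.2 z) }
  have h₀ : ∀ (q : Fin (n + 1)) (T : compactOps γ q) (S : finiteCore γ n),
      IsTensorId γ (by omega : (n - q) + q = n) T.1 S.1 →
        Φ₀ S = matTensorId γ (by omega : (n - q) + q = n) (omega γ q T) := fun q T S hS =>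
    key _ _ (applyMat_of_isTensorId γ _ T S.1 hS)
  refine ⟨Φ₀, h₀, fun Φ hΦ => LinearMap.ext fun S => ?_⟩
  obtain ⟨S, hS⟩ := S
  refine Submodule.iSup_induction' _
    (motive := fun S hS => Φ ⟨S, hS⟩ = Φ₀ ⟨S, hS⟩) ?_ ?_ ?_ hS
  · rintro q S ⟨T, hT, hTS⟩
    exact (hΦ q ⟨T, hT⟩ ⟨S, _⟩ hTS).trans (h₀ q ⟨T, hT⟩ ⟨S, _⟩ hTS).symm
  · exact (map_zero Φ).trans (map_zero Φ₀).symm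
  · intro S S' hS hS' h1 h2
    have e := map_add Φ ⟨S, hS⟩ ⟨S', hS'⟩
    rw [h1, h2, ← map_add] at e
    exact e

/-- The matrix representation `Π^{(n)} : F^{(n)} → M_{N^n}(A)` of the finite core,
`Π^{(n)}(∑_r T_r ⊗ I_{n-r}) = ∑_r Ω^{(r)}(T_r) ⊗ I_{n-r}`. -/
noncomputable def matrixRep {γ : Fin N → C(K, K)} {h : K → K} (hγ : IsSelfSimilarMap γ)
    (hB : AssumptionB γ h) (n : ℕ) : finiteCore γ n →ₗ[ℂ] MatrixFunction K N n :=
  (existsUnique_matrixRep hγ hB n).choose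

theorem isTensorId_self (γ : Fin N → C(K, K)) {p : ℕ} (hn : p + n = n)
    {T : tensorPower γ n →L[ℂ] tensorPower γ n} (hT : T ∈ compactOps γ n) :
    IsTensorId γ hn T T := by
  obtain rfl : p = 0 := by omega
  intro ξ η
  apply Subtype.ext
  change (T _).1 = tensorMul γ hn (T ξ).1 η.1
  have h1 := applyMat_omega γ ⟨T, hT⟩ ⟨tensorMul γ hn ξ.1 η.1, tensorMul_mem γ hn ξ.2 η.2⟩
  refine h1.symm.trans ?_
  rw [show (T ξ).1 = _ from (applyMat_omega γ ⟨T, hT⟩ ξ).symm]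
  change applyMat _ (tensorMul γ hn ξ.1 η.1) = _
  rw [tensorMul_zero_right, tensorMul_zero_right]
  ext y w
  simp [applyMat_apply, FreeModule.rsmul, Matrix.mulVec_smul]

/-- `K(X_γ^{⊗ n}) ⊆ F^{(n)}`. -/
theorem compactOps_le_finiteCore (γ : Fin N → C(K, K)) (n : ℕ) :
    compactOps γ n ≤ finiteCore γ n := fun T hT =>
  Submodule.mem_iSup_of_mem (Fin.last n) ⟨T, hT, isTensorId_self γ _ hT⟩

/-- The fiber `𝒜(P) = {T(P) | T ∈ 𝒜}` of a subspace `𝒜 ⊆ M_{N^n}(A) = C(K, M_{N^n}(ℂ))`. -/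
noncomputable def fiber (𝒜 : Submodule ℂ (MatrixFunction K N n)) (P : K) :
    Submodule ℂ (Matrix (Word N n) (Word N n) ℂ) :=
  𝒜.map ({ toFun := fun T => T P, map_add' := fun _ _ => rfl, map_smul' := fun _ _ => rfl } :
    MatrixFunction K N n →ₗ[ℂ] Matrix (Word N n) (Word N n) ℂ)

open scoped Classical in
/-- The block algebra `C̃(P,R,p)` in `M_{N^n}(ℂ)`, `p + q = n`: the matrices
`∑_l π_{q, i_1 … i_{p-1} j(R,l)}(A)` with `A ∈ M_{N^q}(ℂ)`.  The words `i_1 … i_{p-1} j(R,l)` are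
exactly those `u = (i_1, …, i_p) ∈ Σ^p` with `γ_{i_p} ∘ ⋯ ∘ γ_{i_1}(P) = R`. -/
noncomputable def blockAlgebra {p q : ℕ} (γ : Fin N → C(K, K)) (hn : p + q = n) (P R : K) :
    Submodule ℂ (Matrix (Word N n) (Word N n) ℂ) :=
  LinearMap.range (∑ u : Word N p with wordMap γ p u P = R, blockEmb hn u)

/-- The pairs `(p, R)` with `1 ≤ p ≤ n`, `R ∈ B_γ` and `h^p(R) = P`. -/
structure BranchIndex (γ : Fin N → C(K, K)) (h : K → K) (n : ℕ) (P : K) where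
  p : ℕ
  R : K
  one_le_p : 1 ≤ p
  p_le : p ≤ n
  mem_branchSet : R ∈ branchSet γ
  iterate_eq : h^[p] R = P

/-- The block algebra `C̃(P,R,p)` of the pair `(p, R)`. -/
noncomputable def BranchIndex.block {γ : Fin N → C(K, K)} {h : K → K} {P : K}
    (i : BranchIndex γ h n P) : Submodule ℂ (Matrix (Word N n) (Word N n) ℂ) :=
  blockAlgebra γ (Nat.add_sub_of_le i.p_le : i.p + (n - i.p) = n) P i.R

end Representation

/-! ### Paths of the dynamics: words, end points and the common left inverse. -/

section WordDynamics

variable {K : Type*} [MetricSpace K] {N p q n : ℕ}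

/-! A word of length `n` is a path of `n` steps starting at `P`. Since `h` inverts every branch, the
end point of a path determines all the points on it, so an element of the tensor power takes equal
values at `P` along words with the same end point. Interpolation at finitely many points shows that
this is the only constraint: the fiber of the compact operators at `P` is `orbitMats γ n P`
(`fiber_compactOps`).

For `T ⊗ I` with `p + q = n`, the value at `P` is a sum of blocks, one for each point `z` reached
from `P` in `p` steps, with entry in `orbitMats γ q z`. If `z` is not branched, the block over `z`
is a block over `h z` at level `p - 1` (`exists_blockSum_eq_of_notMem_branchSet`), so one descends.
The descent ends at level `0`, in `orbitMats γ n P`, or at a branched point `R`. Branched points are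
not postcritical, so words starting at `R` have distinct end points, `orbitMats` at `R` is the full
matrix algebra, and all of `C̃(P,R,p)` occurs (`blockSum_mem_sup`, `fiber_range_matrixRep`).

Directness rests on the same assumption: a path meets at most one pair `(p, R)` of the index set
(`BranchIndex.eq_of_passes`), so different blocks have disjoint supports. A nonzero block sum cannot
be constant along orbits: `R` is reached along two different prefixes, and the blocks vanish between
different prefixes (`disjoint_orbitMats_iSup_block`). -/

theorem wordMap_split (γ : Fin N → C(K, K)) (hn : p + q = n) (w : Word N n) (y : K) :
    wordMap γ n w y = wordMap γ q (wordSuf hn w) (wordMap γ p (wordPre hn w) y) := by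
  induction p generalizing n y with
  | zero =>
    obtain rfl : q = n := by omega
    have h1 : wordSuf hn w = w := by
      funext k
      simp [wordSuf]
    rw [h1]
    rfl
  | succ p ih =>
    obtain ⟨m, rfl⟩ : ∃ m, n = m + 1 := ⟨p + q, by omega⟩
    have h1 : wordSuf hn w = wordSuf (by omega : p + q = m) (Fin.tail w) := by
      funext k
      simp only [wordSuf, Fin.tail]
      congr 1
      ext
      simp
      omega
    rw [h1]
    exact ih (by omega) (Fin.tail w) (γ (w 0) y)

theorem wordMap_succ_last (γ : Fin N → C(K, K)) (w : Word N (p + 1)) (y : K) :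
    wordMap γ (p + 1) w y = γ (w (Fin.last p)) (wordMap γ p (Fin.init w) y) :=
  wordMap_split γ rfl w y

/-- This is what makes the end point of a path determine every point on it; only the letters can
remain ambiguous. -/
theorem iterate_wordMap {γ : Fin N → C(K, K)} {h : K → K} (hB : AssumptionB γ h) (w : Word N n)
    (y : K) : h^[n] (wordMap γ n w y) = y := by
  induction n generalizing y with
  | zero => rfl
  | succ n ih =>
    rw [Function.iterate_succ_apply']
    exact (congrArg h (ih _ _)).trans (hB.left_inv _ _)

/-- The images of the branches cover `K`, and the preimage of a point under any branch that hits it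
must be its image under `h`. It guarantees that the index pairs `(p, R)` are realised by actual
words. -/
theorem exists_wordMap_eq {γ : Fin N → C(K, K)} {h : K → K} (hγ : IsSelfSimilarMap γ)
    (hB : AssumptionB γ h) {x y : K} (hxy : h^[n] x = y) : ∃ w, wordMap γ n w y = x := by
  induction n generalizing y with
  | zero => exact ⟨Fin.elim0, hxy.symm⟩
  | succ n ih =>
    obtain ⟨w, hw⟩ := ih rfl
    have : h^[n] x ∈ ⋃ i, Set.range (γ i) := hγ.cover ▸ Set.mem_univ _
    obtain ⟨j, z, hz⟩ := Set.mem_iUnion.1 this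
    rw [Function.iterate_succ_apply', ← hz, hB.left_inv] at hxy
    refine ⟨Fin.cons j w, ?_⟩
    simpa [wordMap, ← hxy, hz] using hw

theorem mem_postcriticalSet_of_wordMap {γ : Fin N → C(K, K)} {y : K} (w : Word N n)
    (hw : wordMap γ n w y ∈ postcriticalSet γ) : y ∈ postcriticalSet γ := by
  induction n generalizing y with
  | zero => exact hw
  | succ n ih =>
    obtain ⟨k, hk, v, hv⟩ := ih (y := γ (w 0) y) (Fin.tail w) hw
    exact ⟨k + 1, by omega, Fin.cons (w 0) v, by simpa [wordMap] using hv⟩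

/-- Two words with the same end point agree after the first step, by applying iterates of `h`.
Different first letters would then produce a branched point one step after `y`, making `y`
postcritical; equal first letters lead to a point that is again not postcritical. -/
theorem wordMap_injective_of_notMem_postcriticalSet {γ : Fin N → C(K, K)} {h : K → K}
    (hB : AssumptionB γ h) {y : K} (hy : y ∉ postcriticalSet γ) :
    Function.Injective fun w : Word N n => wordMap γ n w y := by
  induction n generalizing y with
  | zero => exact fun _ _ _ => Subsingleton.elim _ _
  | succ n ih =>
    intro w w' hww
    have h1 : γ (w 0) y = γ (w' 0) y := by
      rw [← iterate_wordMap hB (Fin.tail w) (γ (w 0) y),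
        ← iterate_wordMap hB (Fin.tail w') (γ (w' 0) y)]
      exact congrArg _ hww
    have h0 : w 0 = w' 0 := by
      by_contra hne
      exact hy ⟨1, le_rfl, fun _ => w 0, y, w 0, w' 0, hne, rfl, h1⟩
    have h2 : γ (w 0) y ∉ postcriticalSet γ := fun h2 =>
      hy (mem_postcriticalSet_of_wordMap (n := 1) (fun _ => w 0) h2)
    have h3 : Fin.tail w = Fin.tail w' := ih h2 (by simpa [wordMap, h0] using hww)
    rw [← Fin.cons_self_tail w, ← Fin.cons_self_tail w', h0, h3]

theorem AssumptionB.notMem_postcriticalSet {γ : Fin N → C(K, K)} {h : K → K}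
    (hB : AssumptionB γ h) {R : K} (hR : R ∈ branchSet γ) : R ∉ postcriticalSet γ := fun hP => by
  have : R ∈ branchSet γ ∩ postcriticalSet γ := ⟨hR, hP⟩
  rw [hB.branchSet_inter] at this
  exact this

/-- A branched point is reached from each of its ancestors along at least two words. -/
theorem exists_ne_wordMap_eq {γ : Fin N → C(K, K)} {h : K → K} (hB : AssumptionB γ h)
    (hp : 1 ≤ p) (u : Word N p) {P : K} (hu : wordMap γ p u P ∈ branchSet γ) :
    ∃ v, v ≠ u ∧ wordMap γ p v P = wordMap γ p u P := by
  obtain ⟨p, rfl⟩ : ∃ m, p = m + 1 := ⟨p - 1, by omega⟩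
  obtain ⟨a, i, j, hij, hi, hj⟩ := hu
  have ha : wordMap γ p (Fin.init u) P = a := by
    rw [wordMap_succ_last] at hi
    simpa [hB.left_inv] using congrArg h hi
  -- Two different letters lead from `a` to the branched point, so one of them is not the last
  -- letter of `u`; only that letter gets changed.
  obtain ⟨k, hk, hka⟩ : ∃ k, k ≠ u (Fin.last p) ∧ wordMap γ (p + 1) u P = γ k a := by
    by_cases hiu : i = u (Fin.last p)
    · exact ⟨j, hiu ▸ hij.symm, hj⟩
    · exact ⟨i, hiu, hi⟩
  refine ⟨Fin.snoc (Fin.init u) k, fun hv => hk ?_, ?_⟩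
  · rw [← hv, Fin.snoc_last]
  · rw [wordMap_succ_last, Fin.snoc_last, Fin.init_snoc, ha, hka]

end WordDynamics

/-! ### Orbit-constant matrices, blocks over a point, and the descent to branched points. -/

section OrbitMatrices

variable {K : Type*} [MetricSpace K] {N p q n : ℕ}

/-- The matrices whose rows and columns agree along words that lead from `P` to the same point. -/
def orbitMats (γ : Fin N → C(K, K)) (n : ℕ) (P : K) :
    Submodule ℂ (Matrix (Word N n) (Word N n) ℂ) where
  carrier := {A | ∀ w w' v v', wordMap γ n w P = wordMap γ n w' P →
    wordMap γ n v P = wordMap γ n v' P → A w v = A w' v'}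
  zero_mem' := fun _ _ _ _ _ _ => rfl
  add_mem' := fun hA hB w w' v v' hw hv => by
    simp [hA w w' v v' hw hv, hB w w' v v' hw hv]
  smul_mem' := fun c A hA w w' v v' hw hv => by
    simp [hA w w' v v' hw hv]

/-- A branched point is not postcritical, so no two words share an end point and the defining
condition is empty. -/
theorem orbitMats_eq_top {γ : Fin N → C(K, K)} {h : K → K} (hB : AssumptionB γ h) {R : K}
    (hR : R ∈ branchSet γ) : orbitMats γ n R = ⊤ := by
  have hinj := wordMap_injective_of_notMem_postcriticalSet (n := n) hB
    (hB.notMem_postcriticalSet hR)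
  refine eq_top_iff.2 fun A _ w w' v v' hw hv => ?_
  rw [hinj hw, hinj hv]

open scoped Classical in
/-- `∑_u π_{q,u}(A)` over the words `u ∈ Σ^p` with `γ_u(P) = z`. -/
noncomputable def blockSum (γ : Fin N → C(K, K)) (hn : p + q = n) (P z : K) :
    Matrix (Word N q) (Word N q) ℂ →ₗ[ℂ] Matrix (Word N n) (Word N n) ℂ :=
  ∑ u : Word N p with wordMap γ p u P = z, blockEmb hn u

open scoped Classical in
theorem blockSum_apply (γ : Fin N → C(K, K)) (hn : p + q = n) (P z : K)
    (A : Matrix (Word N q) (Word N q) ℂ) (w w' : Word N n) :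
    blockSum γ hn P z A w w' =
      if wordPre hn w = wordPre hn w' ∧ wordMap γ p (wordPre hn w) P = z then
        A (wordSuf hn w) (wordSuf hn w') else 0 := by
  simp only [blockSum, LinearMap.sum_apply, Matrix.sum_apply, blockEmb, LinearMap.coe_mk,
    AddHom.coe_mk, Matrix.of_apply]
  split_ifs with h
  · rw [Finset.sum_eq_single (wordPre hn w)]
    · simp [h.1]
    · intro u _ hu
      rw [if_neg fun h' => hu h'.1.symm]
    · intro hu
      exact absurd (by simp [h.2]) hu
  · refine Finset.sum_eq_zero fun u hu => if_neg ?_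
    rintro ⟨h1, h2⟩
    exact h ⟨h1.trans h2.symm, h1 ▸ (Finset.mem_filter.1 hu).2⟩

/-- Only the empty word has length `0`: the block is `A` itself if `z = P` and zero otherwise. -/
theorem blockSum_zero_left {γ : Fin N → C(K, K)} (hn : 0 + q = n) {P z : K}
    {A : Matrix (Word N q) (Word N q) ℂ} (hA : A ∈ orbitMats γ q z) :
    blockSum γ hn P z A ∈ orbitMats γ n P := by
  classical
  obtain rfl : q = n := by omega
  intro w w' v v' hw hv
  have h1 : ∀ w : Word N q, wordSuf hn w = w := fun w => by
    funext k
    simp [wordSuf]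
  have h2 : ∀ w w' : Word N q, wordPre hn w = wordPre hn w' := fun w w' => Subsingleton.elim _ _
  simp only [blockSum_apply, h1, h2 w v, h2 w' v', h2 v v', true_and]
  split_ifs with h
  · obtain rfl : P = z := h
    exact hA w w' v v' hw hv
  · rfl

/-- A block that sits over a point which is not branched is a block over the preceding point. -/
theorem exists_blockSum_eq_of_notMem_branchSet {γ : Fin N → C(K, K)} {h : K → K}
    (hB : AssumptionB γ h) (hn : p + 1 + q = n) (hn' : p + (q + 1) = n) {P z : K}
    (hz : z ∉ branchSet γ) {A : Matrix (Word N q) (Word N q) ℂ} (hA : A ∈ orbitMats γ q z) :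
    ∃ A' ∈ orbitMats γ (q + 1) (h z), blockSum γ hn P z A = blockSum γ hn' P (h z) A' := by
  classical
  -- At most one letter leads from `h z` to `z`. Otherwise `A'` below would also have entries
  -- between different letters, which the block over `z` does not have.
  have key : ∀ i j : Fin N, γ i (h z) = z → γ j (h z) = z → i = j := fun i j hi hj => by
    by_contra hij
    exact hz ⟨h z, i, j, hij, hi.symm, hj.symm⟩
  have hstep : ∀ v v' : Word N (q + 1),
      wordMap γ (q + 1) v (h z) = wordMap γ (q + 1) v' (h z) → γ (v 0) (h z) = γ (v' 0) (h z) := by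
    intro v v' hv
    rw [← iterate_wordMap hB (Fin.tail v) (γ (v 0) (h z)),
      ← iterate_wordMap hB (Fin.tail v') (γ (v' 0) (h z))]
    exact congrArg _ hv
  have htail : ∀ v v' : Word N (q + 1),
      wordMap γ (q + 1) v (h z) = wordMap γ (q + 1) v' (h z) → γ (v 0) (h z) = z →
        wordMap γ q (Fin.tail v) z = wordMap γ q (Fin.tail v') z := by
    intro v v' hv h0
    have h0' := (hstep v v' hv).symm.trans h0
    simpa [wordMap, h0, h0'] using hv
  -- The last letter of the prefix moves into the suffix: `A'` is `A` placed on the words whose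
  -- first step goes from `h z` to `z`.
  refine ⟨Matrix.of fun v v' => if γ (v 0) (h z) = z ∧ γ (v' 0) (h z) = z then
    A (Fin.tail v) (Fin.tail v') else 0, ?_, ?_⟩
  · intro w w' v v' hw hv
    simp only [Matrix.of_apply, hstep w w' hw, hstep v v' hv]
    split_ifs with h0
    · exact hA _ _ _ _ (htail w w' hw ((hstep w w' hw).trans h0.1))
        (htail v v' hv ((hstep v v' hv).trans h0.2))
    · rfl
  · ext w w'
    have hpre : ∀ w : Word N n, Fin.init (wordPre hn w) = wordPre hn' w := fun _ => rfl
    have hlast : ∀ w : Word N n, wordPre hn w (Fin.last p) = wordSuf hn' w 0 := fun _ => rfl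
    have hsuf : ∀ w : Word N n, Fin.tail (wordSuf hn' w) = wordSuf hn w := fun w => by
      funext k
      simp only [wordSuf, Fin.tail]
      congr 1
      ext
      simp
      omega
    simp only [blockSum_apply, Matrix.of_apply, hsuf, wordMap_succ_last, hpre, hlast, ← ite_and]
    refine if_congr ⟨?_, ?_⟩ rfl rfl
    · rintro ⟨h1, h2⟩
      have h3 : wordMap γ p (wordPre hn' w) P = h z := by rw [← h2, hB.left_inv]
      rw [h3] at h2
      refine ⟨⟨?_, h3⟩, h2, ?_⟩
      · rw [← hpre, ← hpre, h1]
      · rwa [← hlast, ← h1, hlast]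
    · rintro ⟨⟨h1, h2⟩, h3, h4⟩
      refine ⟨?_, by rwa [h2]⟩
      rw [← Fin.snoc_init_self (wordPre hn w), ← Fin.snoc_init_self (wordPre hn w'), hpre, hpre,
        hlast, hlast, h1, key _ _ h3 h4]

theorem blockSum_eq_zero {γ : Fin N → C(K, K)} {h : K → K} (hB : AssumptionB γ h)
    (hn : p + q = n) {P z : K} (hz : h^[p] z ≠ P) (A : Matrix (Word N q) (Word N q) ℂ) :
    blockSum γ hn P z A = 0 := by
  classical
  ext w w'
  rw [blockSum_apply, if_neg]
  · rfl
  · rintro ⟨-, rfl⟩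
    exact hz (iterate_wordMap hB _ _)

theorem BranchIndex.block_eq_range {γ : Fin N → C(K, K)} {h : K → K} {P : K}
    (i : BranchIndex γ h n P) :
    i.block = LinearMap.range (blockSum γ (Nat.add_sub_of_le i.p_le) P i.R) := rfl

/-- Descent in `p`: as long as `z` is not branched it is replaced by `h z`, which shortens the
prefix by one letter, until a branched point or the empty prefix is reached. -/
theorem blockSum_mem_sup {γ : Fin N → C(K, K)} {h : K → K} (hB : AssumptionB γ h)
    (hn : p + q = n) {P z : K} {A : Matrix (Word N q) (Word N q) ℂ} (hA : A ∈ orbitMats γ q z) :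
    blockSum γ hn P z A ∈ orbitMats γ n P ⊔ ⨆ i : BranchIndex γ h n P, i.block := by
  induction p generalizing q z with
  | zero => exact Submodule.mem_sup_left (blockSum_zero_left hn hA)
  | succ p ih =>
    by_cases hz : z ∈ branchSet γ
    -- Over a branched point any matrix is admissible, so `hA` plays no role here. If `z` cannot be
    -- reached from `P`, the block is zero.
    · by_cases hzP : h^[p + 1] z = P
      · obtain rfl : q = n - (p + 1) := by omega
        exact Submodule.mem_sup_right (Submodule.mem_iSup_of_mem
          ⟨p + 1, z, by omega, by omega, hz, hzP⟩ ⟨A, rfl⟩)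
      · rw [blockSum_eq_zero hB hn hzP]
        exact zero_mem _
    · obtain ⟨A', hA', e⟩ :=
        exists_blockSum_eq_of_notMem_branchSet hB hn (by omega : p + (q + 1) = n) (P := P) hz hA
      rw [e]
      exact ih _ hA'

/-! ### Directness of the sum: paths through branched points. -/

theorem exists_wordPre_wordSuf (hn : p + q = n) (u : Word N p) (v : Word N q) :
    ∃ w : Word N n, wordPre hn w = u ∧ wordSuf hn w = v :=
  have h := (wordEquiv hn).apply_symm_apply (u, v)
  ⟨(wordEquiv hn).symm (u, v), congrArg Prod.fst h, congrArg Prod.snd h⟩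

/-- The words of length `n` that pass through `R` after `p` steps from `P`. -/
def BranchIndex.Passes {γ : Fin N → C(K, K)} {h : K → K} {P : K} (i : BranchIndex γ h n P)
    (w : Word N n) : Prop :=
  wordMap γ i.p (wordPre (Nat.add_sub_of_le i.p_le) w) P = i.R

/-- If a path met branched points at two different times, the letters in between would lead from the
earlier one to the later one, so the earlier one would be postcritical. At equal times the points
agree because the prefixes do. -/
theorem BranchIndex.eq_of_passes {γ : Fin N → C(K, K)} {h : K → K} (hB : AssumptionB γ h) {P : K}
    {i j : BranchIndex γ h n P} {w : Word N n} (hi : i.Passes w) (hj : j.Passes w) : i = j := by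
  have hlt : ∀ {i j : BranchIndex γ h n P}, i.Passes w → j.Passes w → ¬ i.p < j.p := by
    intro i j hi hj hij
    refine hB.notMem_postcriticalSet i.mem_branchSet ⟨j.p - i.p, by omega,
      wordSuf (Nat.add_sub_of_le hij.le) (wordPre (Nat.add_sub_of_le j.p_le) w), ?_⟩
    have h1 := wordMap_split γ (Nat.add_sub_of_le hij.le)
      (wordPre (Nat.add_sub_of_le j.p_le) w) P
    have h2 : wordMap γ i.p (wordPre (Nat.add_sub_of_le hij.le)
      (wordPre (Nat.add_sub_of_le j.p_le) w)) P = i.R := hi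
    rw [h2] at h1
    rw [← h1]
    exact (show _ = j.R from hj) ▸ j.mem_branchSet
  have hp : i.p = j.p := le_antisymm (not_lt.1 (hlt hj hi)) (not_lt.1 (hlt hi hj))
  obtain ⟨p, R, _, _, _, _⟩ := i
  obtain ⟨p', R', _, _, _, _⟩ := j
  obtain rfl : p = p' := hp
  obtain rfl : R = R' := hi.symm.trans hj
  rfl

theorem BranchIndex.apply_eq_zero {γ : Fin N → C(K, K)} {h : K → K} {P : K}
    {i : BranchIndex γ h n P} {A : Matrix (Word N n) (Word N n) ℂ} (hA : A ∈ i.block)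
    {w w' : Word N n}
    (hw : ¬ (wordPre (Nat.add_sub_of_le i.p_le) w = wordPre (Nat.add_sub_of_le i.p_le) w' ∧
      i.Passes w)) : A w w' = 0 := by
  classical
  rw [i.block_eq_range] at hA
  obtain ⟨T, rfl⟩ := hA
  rw [blockSum_apply]
  exact if_neg hw

/-- The rows supporting a block belong to words that pass through its branched point, and no word
passes through two index pairs. Hence all other blocks vanish on the rows of the given one. -/
theorem iSupIndep_block {γ : Fin N → C(K, K)} {h : K → K} (hB : AssumptionB γ h) (P : K) :
    iSupIndep fun i : BranchIndex γ h n P => i.block := by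
  intro i
  rw [Submodule.disjoint_def]
  intro A hA hA'
  let W : Submodule ℂ (Matrix (Word N n) (Word N n) ℂ) :=
    { carrier := {A | ∀ w w', i.Passes w → A w w' = 0}
      zero_mem' := fun _ _ _ => rfl
      add_mem' := fun hA hA' w w' hw => by simp [hA w w' hw, hA' w w' hw]
      smul_mem' := fun c A hA w w' hw => by simp [hA w w' hw] }
  have hle : (⨆ j : BranchIndex γ h n P, ⨆ _ : j ≠ i, j.block) ≤ W :=
    iSup₂_le fun j hj A hA w w' hw =>
      BranchIndex.apply_eq_zero hA fun h' => hj (BranchIndex.eq_of_passes hB h'.2 hw)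
  ext w w'
  by_cases hw : i.Passes w
  · exact hle hA' w w' hw
  · exact BranchIndex.apply_eq_zero hA fun h' => hw h'.2

/-- A nonzero entry of a sum of blocks sits at two words with a common prefix to some `R`. Rerouting
the row word to `R` along another prefix keeps its end point, hence keeps the entry of an
orbit-constant matrix, but a sum of blocks must vanish at the rerouted position. -/
theorem disjoint_orbitMats_iSup_block {γ : Fin N → C(K, K)} {h : K → K} (hB : AssumptionB γ h)
    (P : K) : Disjoint (orbitMats γ n P) (⨆ i : BranchIndex γ h n P, i.block) := by
  rw [Submodule.disjoint_def]
  intro A hA hA'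
  let W : Submodule ℂ (Matrix (Word N n) (Word N n) ℂ) :=
    { carrier := {A | ∀ w w', (∀ i : BranchIndex γ h n P,
        ¬ (wordPre (Nat.add_sub_of_le i.p_le) w = wordPre (Nat.add_sub_of_le i.p_le) w' ∧
          i.Passes w)) → A w w' = 0}
      zero_mem' := fun _ _ _ => rfl
      add_mem' := fun hA hA' w w' hw => by simp [hA w w' hw, hA' w w' hw]
      smul_mem' := fun c A hA w w' hw => by simp [hA w w' hw] }
  have hle : (⨆ i : BranchIndex γ h n P, i.block) ≤ W :=
    iSup_le fun i A hA w w' hw => BranchIndex.apply_eq_zero hA (hw i)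
  have hW : ∀ {w w'}, A w w' ≠ 0 → ∃ i : BranchIndex γ h n P,
      wordPre (Nat.add_sub_of_le i.p_le) w = wordPre (Nat.add_sub_of_le i.p_le) w' ∧
        i.Passes w := fun {w w'} hne => by
    by_contra! hcon
    exact hne (hle hA' w w' fun i hi => hcon i hi.1 hi.2)
  ext w w'
  by_contra hne
  obtain ⟨i, hpre, hi⟩ := hW hne
  -- The word `v` takes a different prefix `u` to the same branched point and then follows `w`.
  obtain ⟨u, hu, huP⟩ := exists_ne_wordMap_eq hB i.one_le_p
    (wordPre (Nat.add_sub_of_le i.p_le) w) (P := P)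
    ((show _ = i.R from hi) ▸ i.mem_branchSet)
  obtain ⟨v, hv, hv'⟩ := exists_wordPre_wordSuf (Nat.add_sub_of_le i.p_le) u
    (wordSuf (Nat.add_sub_of_le i.p_le) w)
  have hvw : wordMap γ n v P = wordMap γ n w P := by
    rw [wordMap_split γ (Nat.add_sub_of_le i.p_le) v,
      wordMap_split γ (Nat.add_sub_of_le i.p_le) w, hv, hv', huP]
  rw [← hA v w w' w' hvw rfl] at hne
  obtain ⟨j, hpre', hj⟩ := hW hne
  have hiv : i.Passes v := by
    unfold BranchIndex.Passes
    rw [hv, huP]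
    exact hi
  -- The block responsible for the entry at `(v, w')` must be the original one, so `v` and `w'`
  -- would share their prefix; but that of `w'` is that of `w`, not `u`.
  obtain rfl := BranchIndex.eq_of_passes hB hj hiv
  exact hu (by rw [← hv, hpre', hpre])

theorem BranchIndex.exists_passes {γ : Fin N → C(K, K)} {h : K → K} (hγ : IsSelfSimilarMap γ)
    (hB : AssumptionB γ h) {P : K} (i : BranchIndex γ h n P) : ∃ w, i.Passes w := by
  obtain ⟨u, hu⟩ := exists_wordMap_eq hγ hB i.iterate_eq
  have h0 : 0 < N := by have := hγ.two_le; omega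
  obtain ⟨w, hw, -⟩ := exists_wordPre_wordSuf (Nat.add_sub_of_le i.p_le) u fun _ => ⟨0, h0⟩
  exact ⟨w, by rwa [BranchIndex.Passes, hw]⟩

/-- The all-ones matrix is constant along orbits, and the block of the identity is the diagonal
projection onto the words passing through `i`. Their product has entry `1` at `(w, w)` for every
such word `w`. -/
theorem BranchIndex.exists_mul_ne_zero {γ : Fin N → C(K, K)} {h : K → K}
    (hγ : IsSelfSimilarMap γ) (hB : AssumptionB γ h) {P : K} (i : BranchIndex γ h n P) :
    ∃ S ∈ orbitMats γ n P, ∃ T ∈ i.block, S * T ≠ 0 := by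
  classical
  obtain ⟨w, hw⟩ := i.exists_passes hγ hB
  refine ⟨Matrix.of fun _ _ => 1, fun _ _ _ _ _ _ => rfl,
    blockSum γ (Nat.add_sub_of_le i.p_le) P i.R 1, ⟨1, rfl⟩, fun h0 => ?_⟩
  have h1 := congrFun (congrFun h0 w) w
  rw [Matrix.mul_apply, Finset.sum_eq_single w] at h1
  · rw [blockSum_apply, if_pos ⟨rfl, hw⟩] at h1
    simp at h1
  · intro v _ hvw
    rw [blockSum_apply]
    split_ifs with hv
    · have hne : wordSuf (Nat.add_sub_of_le i.p_le) v ≠ wordSuf (Nat.add_sub_of_le i.p_le) w :=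
        fun he => hvw ((wordEquiv (Nat.add_sub_of_le i.p_le)).injective (Prod.ext hv.1 he))
      simp [hne]
    · simp
  · simp

end OrbitMatrices

/-! ### Fibers of the compact operators: constraints and interpolation. -/

section Fibers

variable {K : Type*} [MetricSpace K] [CompactSpace K] {N p q n : ℕ}

theorem exists_continuousMap_eq_one_eq_zero (z : K) (s : Finset K) :
    ∃ g : C(K, ℂ), g z = 1 ∧ ∀ y ∈ s, y ≠ z → g y = 0 := by
  classical
  refine ⟨⟨fun x => ∏ y ∈ s.erase z, (((dist x y / dist z y : ℝ)) : ℂ), by fun_prop⟩, ?_, ?_⟩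
  · refine Finset.prod_eq_one fun y hy => ?_
    rw [div_self (dist_ne_zero.2 (Finset.ne_of_mem_erase hy).symm)]
    simp
  · exact fun y hy hyz => Finset.prod_eq_zero (Finset.mem_erase.2 ⟨hyz, hy⟩) (by simp)

/-- An elementary tensor is a product of values at the points of the path, and the end point
determines these points through `h`. The equality passes to the closed span. -/
theorem apply_eq_of_mem_tensorPower {γ : Fin N → C(K, K)} {h : K → K} (hB : AssumptionB γ h)
    {f : FreeModule K N n} (hf : f ∈ tensorPower γ n) {y : K} {w w' : Word N n}
    (hw : wordMap γ n w y = wordMap γ n w' y) : f y w = f y w' := by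
  induction n generalizing y with
  | zero => rw [Subsingleton.elim w w']
  | succ n ih =>
    let L : FreeModule K N (n + 1) →L[ℂ] ℂ :=
      { toFun := fun f => f y w - f y w'
        map_add' := fun f g => by simp; ring
        map_smul' := fun c f => by simp; ring
        cont := by fun_prop }
    have h1 : γ (w 0) y = γ (w' 0) y := by
      rw [← iterate_wordMap hB (Fin.tail w) (γ (w 0) y),
        ← iterate_wordMap hB (Fin.tail w') (γ (w' 0) y)]
      exact congrArg _ hw
    refine sub_eq_zero.1 ((Submodule.mem_bot ℂ).1
      (FreeModule.mem_closure_map L ⊥ isClosed_singleton ?_ hf))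
    rintro _ ⟨ξ, hξ, x, rfl⟩
    refine (Submodule.mem_bot ℂ).2 (sub_eq_zero.2 ?_)
    have h2 : cographPt γ (w 0) y = cographPt γ (w' 0) y := Subtype.ext (Prod.ext h1 rfl)
    have h3 : wordMap γ n (Fin.tail w) (γ (w' 0) y) = wordMap γ n (Fin.tail w') (γ (w' 0) y) := by
      simpa [wordMap, h1] using hw
    simp [tensorStep, h1, h2, ih hξ h3]

/-- Rank one matrices inherit the condition from their two vectors, and it is linear and closed in
`M`. -/
theorem eval_mem_orbitMats {γ : Fin N → C(K, K)} {h : K → K} (hB : AssumptionB γ h)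
    {M : MatrixFunction K N n} (hM : M ∈ compactMats γ n) (z : K) : M z ∈ orbitMats γ n z := by
  have hcl : IsClosed {M : MatrixFunction K N n | M z ∈ orbitMats γ n z} := by
    have : {M : MatrixFunction K N n | M z ∈ orbitMats γ n z} =
        ⋂ (w) (w') (v) (v') (_ : wordMap γ n w z = wordMap γ n w' z)
          (_ : wordMap γ n v z = wordMap γ n v' z),
            {M : MatrixFunction K N n | M z w v = M z w' v'} := by
      ext M
      simp only [Set.mem_iInter]
      rfl
    rw [this]
    have hc : ∀ w v, Continuous fun M : MatrixFunction K N n => M z w v := fun w v =>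
      (continuous_eval_const z).matrix_elem w v
    exact isClosed_iInter fun w => isClosed_iInter fun w' => isClosed_iInter fun v =>
      isClosed_iInter fun v' => isClosed_iInter fun _ => isClosed_iInter fun _ =>
        isClosed_eq (hc w v) (hc w' v')
  let W : Submodule ℂ (MatrixFunction K N n) :=
    (orbitMats γ n z).comap
      ({ toFun := fun T => T z, map_add' := fun _ _ => rfl, map_smul' := fun _ _ => rfl } :
        MatrixFunction K N n →ₗ[ℂ] Matrix (Word N n) (Word N n) ℂ)
  refine Submodule.topologicalClosure_minimal (t := W) _ (Submodule.span_le.2 ?_) hcl hM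
  rintro _ ⟨x, hx, y, hy, rfl⟩ w w' v v' hw hv
  change x z w * star (y z v) = x z w' * star (y z v')
  rw [apply_eq_of_mem_tensorPower hB hx hw, apply_eq_of_mem_tensorPower hB hy hv]

/-- The values of `K(X^{⊗ n})` at finitely many points can be prescribed independently. -/
theorem exists_mem_compactMats (γ : Fin N → C(K, K)) {z : K} (s : Finset K)
    {A : Matrix (Word N n) (Word N n) ℂ} (hA : A ∈ orbitMats γ n z) :
    ∃ M ∈ compactMats γ n, M z = A ∧ ∀ y ∈ s, y ≠ z → M y = 0 := by
  classical
  obtain ⟨g, hg1, hg0⟩ := exists_continuousMap_eq_one_eq_zero z s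
  -- `I` is the set of end points of paths from `z`. The functions `F x` separate these points, so
  -- `e x` at `z` is the indicator of the words ending at `x`.
  let I : Finset K := Finset.univ.image fun w : Word N n => wordMap γ n w z
  have hI : ∀ w, wordMap γ n w z ∈ I := fun w => Finset.mem_image_of_mem _ (Finset.mem_univ w)
  have hrep : ∀ x : I, ∃ w, wordMap γ n w z = x := fun x => by
    obtain ⟨w, -, hw⟩ := Finset.mem_image.1 x.2
    exact ⟨w, hw⟩
  choose rep hrep using hrep
  choose F hF1 hF0 using fun x : I => exists_continuousMap_eq_one_eq_zero x.1 I
  let e : I → FreeModule K N n := fun x =>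
    .mk (fun y => WithLp.toLp 2 fun w => F x (wordMap γ n w y)) (by fun_prop)
  have he : ∀ x w, e x z w = if x = ⟨wordMap γ n w z, hI w⟩ then 1 else 0 := fun x w => by
    change F x (wordMap γ n w z) = _
    split_ifs with hx
    · subst hx
      exact hF1 _
    · exact hF0 x _ (hI w) fun h' => hx (Subtype.ext h'.symm)
  -- At `z` the rank one matrices are matrix units for pairs of end points, so the sum reproduces
  -- `A`, which depends only on end points. The factor `g` kills the sum at the other points of `s`.
  refine ⟨∑ x, ∑ x', A (rep x) (rep x') • rankOneMat ((e x).rsmul g) (e x'), ?_, ?_, ?_⟩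
  · refine sum_mem fun x _ => sum_mem fun x' _ => Submodule.smul_mem _ _
      (Submodule.le_topologicalClosure _ (Submodule.subset_span ⟨_, ?_, _, ?_, rfl⟩))
    · exact rsmul_mem_tensorPower γ (pullback_mem γ (F x) n) g
    · exact pullback_mem γ (F x') n
  · ext w w'
    simp only [ContinuousMap.coe_sum, Finset.sum_apply, ContinuousMap.coe_smul, Pi.smul_apply,
      Matrix.sum_apply, Matrix.smul_apply, smul_eq_mul, rankOneMat, ContinuousMap.coe_mk,
      Matrix.of_apply, FreeModule.rsmul, FreeModule.mk_apply, PiLp.smul_apply, hg1, one_mul, he]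
    rw [Finset.sum_eq_single ⟨wordMap γ n w z, hI w⟩ (fun x _ hx => by simp [hx]) (by simp),
      Finset.sum_eq_single ⟨wordMap γ n w' z, hI w'⟩ (fun x _ hx => by simp [hx]) (by simp)]
    simp only [if_true, star_one, mul_one]
    exact hA _ _ _ _ (hrep _) (hrep _)
  · intro y hy hyz
    ext w w'
    simp [rankOneMat, FreeModule.rsmul, hg0 y hy hyz, Matrix.sum_apply]

/-! ### The operators `T ⊗ I` and the fibers of the matrix representation. -/

theorem omega_mem_compactMats (γ : Fin N → C(K, K)) (T : compactOps γ n) :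
    omega γ n T ∈ compactMats γ n :=
  ((LinearEquiv.ofBijective _ (bijective_restrictMat γ n)).symm T).2

theorem exists_omega_eq (γ : Fin N → C(K, K)) {M : MatrixFunction K N n}
    (hM : M ∈ compactMats γ n) : ∃ T, omega γ n T = M :=
  ⟨LinearEquiv.ofBijective _ (bijective_restrictMat γ n) ⟨M, hM⟩,
    congrArg Subtype.val
      ((LinearEquiv.ofBijective _ (bijective_restrictMat γ n)).symm_apply_apply ⟨M, hM⟩)⟩

/-- The matrix of `T`, tensored with the identity, acts correctly on the tensors `ξ ⊗ η`. As these
span a dense subspace, it preserves the closed subspace `tensorPower γ n` and can be restricted to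
it. -/
theorem exists_isTensorId (γ : Fin N → C(K, K)) (hn : p + q = n) (T : compactOps γ q) :
    ∃ S, IsTensorId γ hn T.1 S := by
  let L : FreeModule K N n →L[ℂ] FreeModule K N n :=
    applyMat (matTensorId γ hn (omega γ q T))
  have hL : ∀ (ξ : tensorPower γ q) (η : FreeModule K N p),
      L (tensorMul γ hn ξ.1 η) = tensorMul γ hn (T.1 ξ).1 η := fun ξ η => by
    change applyMat _ _ = _
    rw [applyMat_matTensorId, applyMat_omega]
  have hmem : ∀ f ∈ tensorPower γ n, L f ∈ tensorPower γ n := fun f hf => by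
    refine FreeModule.mem_closure_map L _ (isClosed_tensorPower γ n) ?_
      (tensorPower_le_closure γ hn hf)
    rintro _ ⟨ξ, hξ, η, hη, rfl⟩
    rw [hL ⟨ξ, hξ⟩]
    exact tensorMul_mem γ hn (T.1 ⟨ξ, hξ⟩).2 hη
  exact ⟨(L.comp (tensorPower γ n).subtypeL).codRestrict (tensorPower γ n) fun f => hmem f.1 f.2,
    fun ξ η => Subtype.ext (hL ξ η.1)⟩

theorem matTensorId_self (γ : Fin N → C(K, K)) (hn : p + n = n) (M : MatrixFunction K N n) :
    matTensorId γ hn M = M := by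
  obtain rfl : p = 0 := by omega
  ext y w w'
  have h1 : ∀ w : Word N n, wordSuf hn w = w := fun w => by
    funext k
    simp [wordSuf]
  have h2 : ∀ w : Word N n, wordPre hn w = default := fun w => Subsingleton.elim _ _
  simp [matTensorId, blockEmb, h1, h2, wordMap]

-- The block labelled `u` depends on `u` only through its end point, so the words can be grouped by
-- end point; this turns `M ⊗ I` into the blocks to which the descent applies.
open scoped Classical in
theorem matTensorId_apply_eq_sum_blockSum (γ : Fin N → C(K, K)) (hn : p + q = n)
    (M : MatrixFunction K N q) (P : K) :
    matTensorId γ hn M P = ∑ z ∈ Finset.univ.image fun u : Word N p => wordMap γ p u P,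
      blockSum γ hn P z (M z) := by
  change ∑ u, blockEmb hn u (M (wordMap γ p u P)) = _
  rw [← Finset.sum_fiberwise_of_maps_to (t := Finset.univ.image fun u : Word N p => wordMap γ p u P)
    (g := fun u : Word N p => wordMap γ p u P) fun u hu => Finset.mem_image_of_mem _ hu]
  refine Finset.sum_congr rfl fun z _ => ?_
  rw [blockSum, LinearMap.sum_apply]
  exact Finset.sum_congr rfl fun u hu => by rw [(Finset.mem_filter.1 hu).2]

theorem matrixRep_apply {γ : Fin N → C(K, K)} {h : K → K} (hγ : IsSelfSimilarMap γ)
    (hB : AssumptionB γ h) (q : Fin (n + 1)) (T : compactOps γ q) (S : finiteCore γ n)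
    (hS : IsTensorId γ (by omega : (n - q) + q = n) T.1 S.1) :
    matrixRep hγ hB n S = matTensorId γ (by omega : (n - q) + q = n) (omega γ q T) :=
  (existsUnique_matrixRep hγ hB n).choose_spec.1 q T S hS

theorem matrixRep_apply_compact {γ : Fin N → C(K, K)} {h : K → K} (hγ : IsSelfSimilarMap γ)
    (hB : AssumptionB γ h) (T : compactOps γ n) :
    matrixRep hγ hB n ⟨T.1, compactOps_le_finiteCore γ n T.2⟩ = omega γ n T :=
  (matrixRep_apply hγ hB (Fin.last n) T _ (isTensorId_self γ _ T.2)).trans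
    (matTensorId_self γ _ _)

/-- On compact operators the representation is `omega`, whose range is `compactMats γ n`. The
constraint at `P` and interpolation at the single point `P` give the two inclusions. -/
theorem fiber_compactOps {γ : Fin N → C(K, K)} {h : K → K} (hγ : IsSelfSimilarMap γ)
    (hB : AssumptionB γ h) (n : ℕ) (P : K) :
    fiber (((compactOps γ n).submoduleOf (finiteCore γ n)).map (matrixRep hγ hB n)) P =
      orbitMats γ n P := by
  apply le_antisymm
  · rintro _ ⟨_, ⟨⟨S, hS⟩, hT, rfl⟩, rfl⟩
    change matrixRep hγ hB n ⟨S, hS⟩ P ∈ _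
    rw [show matrixRep hγ hB n ⟨S, hS⟩ = _ from matrixRep_apply_compact hγ hB ⟨S, hT⟩]
    exact eval_mem_orbitMats hB (omega_mem_compactMats γ _) P
  · intro A hA
    obtain ⟨M, hM, rfl, -⟩ := exists_mem_compactMats γ ∅ hA
    obtain ⟨T, rfl⟩ := exists_omega_eq γ hM
    exact ⟨_, ⟨⟨T.1, compactOps_le_finiteCore γ n T.2⟩, T.2, matrixRep_apply_compact hγ hB T⟩, rfl⟩

/-- The descent places the value at `P` of each `T ⊗ I` in the right hand side. Conversely, a single
block over `R` is isolated by choosing `T` with prescribed value at `R` and value zero at the other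
points reached in `p` steps. -/
theorem fiber_range_matrixRep {γ : Fin N → C(K, K)} {h : K → K} (hγ : IsSelfSimilarMap γ)
    (hB : AssumptionB γ h) (n : ℕ) (P : K) :
    fiber (LinearMap.range (matrixRep hγ hB n)) P =
      orbitMats γ n P ⊔ ⨆ i : BranchIndex γ h n P, i.block := by
  classical
  apply le_antisymm
  · rintro _ ⟨_, ⟨⟨S, hS⟩, rfl⟩, rfl⟩
    change matrixRep hγ hB n ⟨S, hS⟩ P ∈ _
    refine Submodule.iSup_induction' _ (motive := fun S hS => matrixRep hγ hB n ⟨S, hS⟩ P ∈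
      orbitMats γ n P ⊔ ⨆ i : BranchIndex γ h n P, i.block) ?_ ?_ ?_ hS
    · rintro q S ⟨T, hT, hTS⟩
      rw [matrixRep_apply hγ hB q ⟨T, hT⟩ _ hTS, matTensorId_apply_eq_sum_blockSum]
      exact sum_mem fun z _ =>
        blockSum_mem_sup hB _ (eval_mem_orbitMats hB (omega_mem_compactMats γ _) z)
    · have h0 : matrixRep hγ hB n ⟨0, zero_mem _⟩ = 0 := map_zero _
      rw [h0]
      exact zero_mem _
    · intro S S' hS hS' h1 h2
      have e : matrixRep hγ hB n ⟨S + S', add_mem hS hS'⟩ = _ :=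
        map_add (matrixRep hγ hB n) ⟨S, hS⟩ ⟨S', hS'⟩
      rw [e]
      exact add_mem h1 h2
  · refine sup_le ?_ (iSup_le fun i => ?_)
    · rw [← fiber_compactOps hγ hB]
      exact Submodule.map_mono LinearMap.map_le_range
    · rw [i.block_eq_range]
      rintro _ ⟨A, rfl⟩
      obtain ⟨u, hu⟩ := exists_wordMap_eq hγ hB i.iterate_eq
      -- The finite core labels its summands by `q` and writes the prefix length as `n - q`; with `q
      -- = n - i.p` this equals `i.p` only propositionally, which `hcast` repairs below.
      have hn : n - (n - i.p) + (n - i.p) = n := by have := i.p_le; omega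
      have hp : n - (n - i.p) = i.p := by have := i.p_le; omega
      -- Interpolation can reach an arbitrary `A` because the branched point `i.R` imposes no
      -- constraint.
      have hA : A ∈ orbitMats γ (n - i.p) i.R := by
        rw [orbitMats_eq_top hB i.mem_branchSet]
        trivial
      obtain ⟨M, hM, hMR, hM0⟩ := exists_mem_compactMats γ
        (Finset.univ.image fun u : Word N i.p => wordMap γ i.p u P) hA
      obtain ⟨T, rfl⟩ := exists_omega_eq γ hM
      obtain ⟨S, hS⟩ := exists_isTensorId γ hn T
      let q : Fin (n + 1) := ⟨n - i.p, by omega⟩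
      have hSc : S ∈ finiteCore γ n := Submodule.mem_iSup_of_mem q ⟨T.1, T.2, hS⟩
      refine ⟨_, ⟨⟨S, hSc⟩, rfl⟩, ?_⟩
      change matrixRep hγ hB n ⟨S, hSc⟩ P = _
      rw [matrixRep_apply hγ hB q T _ hS]
      have hcast : ∀ {p : ℕ} (hn : p + (n - i.p) = n) (hn' : i.p + (n - i.p) = n),
          matTensorId γ hn (omega γ (n - i.p) T) = matTensorId γ hn' (omega γ (n - i.p) T) := by
        intro p hn hn'
        obtain rfl : p = i.p := by omega
        rfl
      rw [show matTensorId γ _ (omega γ q T) = _ from hcast hn (Nat.add_sub_of_le i.p_le),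
        matTensorId_apply_eq_sum_blockSum, Finset.sum_eq_single i.R]
      · rw [hMR]
      · intro z hz hzR
        rw [hM0 z hz hzR, map_zero]
      -- The block over `i.R` really occurs in the sum, since the word `u` leads from `P` to `i.R`.
      · intro hR
        exact absurd (Finset.mem_image.2 ⟨u, Finset.mem_univ _, hu⟩) hR

end Fibers

theorem mainTheorem5 {K : Type*} [MetricSpace K] [CompactSpace K] {N : ℕ}
    (γ : Fin N → C(K, K)) (h : K → K) (hγ : IsSelfSimilarMap γ) (hB : AssumptionB γ h)
    (n : ℕ) (P : K) (hP : P ∈ postcriticalSet γ) :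
    fiber (LinearMap.range (matrixRep hγ hB n)) P =
        fiber (((compactOps γ n).submoduleOf (finiteCore γ n)).map (matrixRep hγ hB n)) P ⊔
          ⨆ i : BranchIndex γ h n P, i.block ∧
      iSupIndep (fun i : BranchIndex γ h n P => i.block) ∧
      Disjoint
        (fiber (((compactOps γ n).submoduleOf (finiteCore γ n)).map (matrixRep hγ hB n)) P)
        (⨆ i : BranchIndex γ h n P, i.block) ∧
      ∀ i : BranchIndex γ h n P,
        ∃ S ∈ fiber (((compactOps γ n).submoduleOf (finiteCore γ n)).map (matrixRep hγ hB n)) P,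
          ∃ T ∈ i.block, S * T ≠ 0 := by
  rw [fiber_compactOps, fiber_range_matrixRep]
  exact ⟨rfl, iSupIndep_block hB P, disjoint_orbitMats_iSup_block hB P,
    fun i => i.exists_mul_ne_zero hγ hB⟩
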